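/- Let $p \ge 3$ be a prime number and let $N, n \ge 1$ be integers with $n$ coprime to $p$. Put $$\tau_{p,N} := 2(p-1)\left(\frac{\log 2}{\log 3} + \frac N2\right) + \frac{\log N}{\log 3}, \qquad \sigma_{p,n} := 2np\left(\frac{\log 2}{\log 3} + (p-1)\left(3 + \frac{2\log 2}{\log 3}\right) + 1\right),$$ both of which are positive. Let $\mathbb F$ be any finite field of characteristic $p$, and fix any embedding $\iota : \overline{\mathbb Q} \hookrightarrow \mathbb C$. For a character $\chi : \mathbb F^\times \to \overline{\mathbb Q}^\times$, an additive character $\psi : \mathbb F \to \overline{\mathbb Q}^\times$ and $\alpha \in \mathbb F^\times$, define the Gauss and Kloosterman sums $$G_{\mathbb F}(\chi,\psi) := -\sum_{x \in \mathbb F^\times} \chi(x)\psi(x), \qquad \mathrm{Kl}_{\mathbb F}(\psi,\alpha) := -\sum_{x \in \mathbb F^\times} \psi\left(x + \frac{\alpha}{x}\right).$$ Let $\varepsilon_{\mathbb F}(\chi,\psi) \in [0,2\pi)$ be the argument of $\iota(G_{\mathbb F}(\chi,\psi))$ when $\psi$ is nontrivial. Let $$R_N := \left\{\tfrac{2j\pi}{N}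 : 0 \le j \le N-1\right\}, \qquad \Gamma_{\mathbb F,n} := \{\varepsilon_{\mathbb F}(\chi,\psi') : \chi \text{ of exact order } n,\ \psi' \text{ nontrivial}\}.$$ For $x \in \mathbb R$ and a finite set $I \subset \mathbb R$ write $\operatorname{dist}(x,I) := \min_{y \in I}|x-y|$, with $\operatorname{dist}(x,\emptyset) := +\infty$. Then, for every nontrivial additive character $\psi$ on $\mathbb F$ and every $\alpha \in \mathbb F^\times$, there is a unique $\theta = \theta_{\mathbb F}(\psi,\alpha) \in [0,\pi]$ with $\iota(\mathrm{Kl}_{\mathbb F}(\psi,\alpha)) = 2\sqrt{|\mathbb F|}\cos\theta$, and it satisfies 1. $\min\{\operatorname{dist}(\theta, R_N),\ \operatorname{dist}(2\pi - \theta, R_N)\} \ge |\mathbb F|^{-\tau_{p,N}}$; 2. $\min\{\operatorname{dist}(\theta, \Gamma_{\mathbb F,n}),\ \operatorname{dist}(2\pi - \theta, \Gamma_{\mathbb F,n})\} \ge |\mathbb F|^{-\sigma_{p,n}}$. -/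

import Mathlib

noncomputable section

/-- The Gauss sum `- ∑_{x ∈ Fˣ} χ(x) ψ(x)`; a `MulChar` is a character of `Fˣ` extended by `0`. -/
def signedGaussSum {F R : Type*} [Field F] [Fintype F] [CommRing R]
    (χ : MulChar F R) (ψ : AddChar F R) : R :=
  -gaussSum χ ψ

/-- The Kloosterman sum `- ∑_{x ∈ Fˣ} ψ(x + α / x)`. -/
def kloostermanSum {F R : Type*} [Field F] [Fintype F] [DecidableEq F] [CommRing R]
    (ψ : AddChar F R) (α : Fˣ) : R :=
  -∑ x : Fˣ, ψ ((x : F) + (α : F) / (x : F))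

/-- The argument of a complex number, taken in `[0, 2π)`. -/
def argTwoPi (z : ℂ) : ℝ :=
  toIcoMod Real.two_pi_pos 0 z.arg

/-- The angle in `[0, 2π)` of the Gauss sum of `χ` and `ψ`, in the complex embedding `ι`. -/
def gaussAngle {F : Type*} [Field F] [Fintype F] (ι : AlgebraicClosure ℚ →+* ℂ)
    (χ : MulChar F (AlgebraicClosure ℚ)) (ψ : AddChar F (AlgebraicClosure ℚ)) : ℝ :=
  argTwoPi (ι (signedGaussSum χ ψ))

/-- The angle `θ ∈ [0, π]` of the Kloosterman sum, determined by `ι(Kl) = 2 √|F| cos θ`. -/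
def kloostermanAngle {F : Type*} [Field F] [Fintype F] [DecidableEq F]
    (ι : AlgebraicClosure ℚ →+* ℂ) (ψ : AddChar F (AlgebraicClosure ℚ)) (α : Fˣ) : ℝ :=
  Real.arccos ((ι (kloostermanSum ψ α)).re / (2 * √(Fintype.card F : ℝ)))

/-- The angles in `[0, 2π)` of the `N`-th roots of unity. -/
def rootOfUnityAngles (N : ℕ) : Set ℝ :=
  {y | ∃ j : ℕ, j < N ∧ y = 2 * (j : ℝ) * Real.pi / (N : ℝ)}

/-- The angles of all Gauss sums over `F` attached to a multiplicative character of exact order `n`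
and a nontrivial additive character. -/
def gaussAngles (F : Type*) [Field F] [Fintype F] (ι : AlgebraicClosure ℚ →+* ℂ) (n : ℕ) :
    Set ℝ :=
  {y | ∃ (χ : MulChar F (AlgebraicClosure ℚ)) (ψ : AddChar F (AlgebraicClosure ℚ)),
    orderOf χ = n ∧ ψ ≠ 1 ∧ y = gaussAngle ι χ ψ}

/-- The exponent `τ_{p,N}`. -/
def tauExponent (p N : ℕ) : ℝ :=
  2 * ((p : ℝ) - 1) * (Real.log 2 / Real.log 3 + (N : ℝ) / 2) + Real.log (N : ℝ) / Real.log 3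

/-- The exponent `σ_{p,n}`. -/
def sigmaExponent (p n : ℕ) : ℝ :=
  2 * (n : ℝ) * (p : ℝ) *
    (Real.log 2 / Real.log 3 + ((p : ℝ) - 1) * (3 + 2 * Real.log 2 / Real.log 3) + 1)

end

/-!
The function `f ↦ ψ(∑ (x + α / x))`, the sum over the roots `x` of a monic polynomial `f`, is
completely multiplicative, and its `L`-function is the polynomial `1 - Kl T + q T ^ 2`, where `q` is
the order of the field. By Newton's identities the Kloosterman sum over the extension of degree `m`
is therefore the power sum `u ^ m + v ^ m` of the reciprocal roots `u`, `v`. Orthogonality bounds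
the Kloosterman sums over the extensions of even degree by numbers of points on the curves
`y ^ q - y + b = x + α / x`, and Stepanov's method bounds these; hence `|Kl| ≤ 2 √q`, and the angle
exists.

The distances are bounded below by a Liouville argument: if a nonzero algebraic integer of degree
`d` has all its conjugates of absolute value at most `B`, then each of them has absolute value at
least `B ^ (1 - d)`. For roots of unity it is applied to
`(u ^ N - v ^ N) ^ 2 = -(2 q ^ (N / 2) sin (N θ)) ^ 2`, an integral polynomial in `Kl` and `q`; for
the Gauss sum `G` of a nontrivial character with angle `ε`, to
`Kl - (G + conj G) = 2 √q (cos θ - cos ε)`. Neither number vanishes: modulo a prime above `p` every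
additive character becomes trivial, so that `Kl` becomes `1`, while `q` and the Gauss sums become
`0`. The Gauss sum of the trivial character is `1`, whose angle is the case `N = 1` of a root of
unity.
-/

open Polynomial Polynomial.Bivariate NumberField

section Stepanov

variable {K : Type*} [Field K]

/-- `f = ∑ c i j x ^ i Y ^ j` with `i ≤ m` and `j ≤ n`, where `Y` is the outer variable: the shape
of the polynomials in Stepanov's method. -/
def HasBidegreeLE (f : K[X][Y]) (m n : ℕ) : Prop :=
  ∀ i j, (f.coeff j).coeff i ≠ 0 → i ≤ m ∧ j ≤ n

namespace HasBidegreeLE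

variable {f : K[X][Y]} {m n : ℕ}

theorem natDegree_coeff_le (hf : HasBidegreeLE f m n) (j : ℕ) : (f.coeff j).natDegree ≤ m :=
  natDegree_le_iff_coeff_eq_zero.mpr fun i hi => by
    by_contra h
    exact hi.not_ge (hf i j h).1

theorem le_of_coeff_ne_zero (hf : HasBidegreeLE f m n) {j : ℕ} (hj : f.coeff j ≠ 0) : j ≤ n := by
  obtain ⟨i, hi⟩ := Polynomial.support_nonempty.mpr hj
  exact (hf i j (mem_support_iff.mp hi)).2

theorem map_mapRingHom (hf : HasBidegreeLE f m n) (φ : K →+* K) :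
    HasBidegreeLE (f.map (mapRingHom φ)) m n := fun i j h =>
  hf i j fun hfij => h (by rw [coeff_map, coe_mapRingHom, coeff_map, hfij, map_zero])

theorem natDegree_eval_X_pow_le (hf : HasBidegreeLE f m n) (P : ℕ) :
    (eval (X ^ P) f).natDegree ≤ m + P * n := by
  rw [eval_eq_sum, sum_def]
  refine natDegree_sum_le_of_forall_le _ _ fun j hj => natDegree_mul_le.trans ?_
  rw [← pow_mul, natDegree_X_pow]
  gcongr
  · exact hf.natDegree_coeff_le j
  · exact hf.le_of_coeff_ne_zero (mem_support_iff.mp hj)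

end HasBidegreeLE

theorem coeff_coeff_swap (f : K[X][Y]) (i j : ℕ) :
    ((swap f).coeff j).coeff i = (f.coeff i).coeff j := by
  induction f using Polynomial.induction_on' with
  | add f g hf hg => simp only [map_add, coeff_add, hf, hg]
  | monomial n a =>
    induction a using Polynomial.induction_on' with
    | add a b ha hb => simp only [map_add, coeff_add, ha, hb]
    | monomial m r =>
      rw [swap_monomial_monomial]
      simp only [coeff_monomial]
      split_ifs <;> simp_all [coeff_monomial]

theorem HasBidegreeLE.swap {f : K[X][Y]} {m n : ℕ} (hf : HasBidegreeLE f m n) :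
    HasBidegreeLE (swap f) n m := fun i j h => (hf j i (coeff_coeff_swap f i j ▸ h)).symm

/-- The polynomial `∑ c j i x ^ i Y ^ j`, as a linear function of its coefficients. -/
noncomputable def ofCoeffs (m n : ℕ) : (Fin (n + 1) → Fin (m + 1) → K) →ₗ[K] K[X][Y] where
  toFun c := ∑ j : Fin (n + 1), ∑ i : Fin (m + 1), monomial j (monomial i (c j i))
  map_add' c d := by simp only [Pi.add_apply, map_add, Finset.sum_add_distrib]
  map_smul' r c := by simp only [Pi.smul_apply, smul_monomial, Finset.smul_sum, RingHom.id_apply]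

theorem coeff_coeff_ofCoeffs {m n : ℕ} (c : Fin (n + 1) → Fin (m + 1) → K) (i : Fin (m + 1))
    (j : Fin (n + 1)) : ((ofCoeffs m n c).coeff j).coeff i = c j i := by
  simp [ofCoeffs, coeff_monomial, Fin.val_inj]

theorem hasBidegreeLE_ofCoeffs {m n : ℕ} (c : Fin (n + 1) → Fin (m + 1) → K) :
    HasBidegreeLE (ofCoeffs m n c) m n := by
  intro i j h
  by_contra hij
  refine h ?_
  simp only [ofCoeffs, LinearMap.coe_mk, AddHom.coe_mk, finsetSum_coeff]
  refine Finset.sum_eq_zero fun l _ => Finset.sum_eq_zero fun k _ => ?_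
  rw [coeff_monomial]
  split_ifs with hl
  · exact coeff_monomial_of_ne _ (by omega)
  · exact coeff_zero i

theorem ofCoeffs_injective (m n : ℕ) : Function.Injective (ofCoeffs (K := K) m n) := by
  intro c d h
  ext j i
  rw [← coeff_coeff_ofCoeffs c, h, coeff_coeff_ofCoeffs]

theorem exists_ne_zero_eq_zero_of_natDegree_le {V : Type*} [AddCommGroup V] [Module K V]
    [Module.Finite K V] (T : V →ₗ[K] K[X]) {d : ℕ} (hT : ∀ v, (T v).natDegree ≤ d)
    (hd : d + 1 < Module.finrank K V) : ∃ v ≠ 0, T v = 0 := by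
  have hker : LinearMap.ker ((toFn (d + 1)).comp T) ≠ ⊥ :=
    LinearMap.ker_ne_bot_of_finrank_lt (by rwa [Module.finrank_fin_fun])
  obtain ⟨v, hv, hv0⟩ := Submodule.exists_mem_ne_zero_of_ne_bot hker
  refine ⟨v, hv0, ?_⟩
  ext i
  rcases lt_or_ge i (d + 1) with hi | hi
  · exact congrFun (LinearMap.mem_ker.mp hv) ⟨i, hi⟩
  · rw [coeff_eq_zero_of_natDegree_lt ((hT v).trans_lt hi), coeff_zero]

/- The monomials `x ^ (i + P j)` with `i < P` are pairwise distinct. -/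
theorem eq_zero_of_eval_X_pow_eq_zero {P : ℕ} {f : K[X][Y]}
    (hf : ∀ j, (f.coeff j).natDegree < P) (h : eval (X ^ P) f = 0) : f = 0 := by
  ext j k
  rcases le_or_gt P k with hk | hk
  · simp only [coeff_zero, coeff_eq_zero_of_natDegree_lt ((hf j).trans_le hk)]
  calc (f.coeff j).coeff k = (eval (X ^ P) f).coeff (k + P * j) := by
        rw [eval_eq_sum, sum_def, finsetSum_coeff, Finset.sum_eq_single j]
        · rw [← pow_mul, coeff_mul_X_pow]
        · intro l _ hl
          rw [← pow_mul, coeff_mul_X_pow']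
          split_ifs with hle
          · apply coeff_eq_zero_of_natDegree_lt
            refine (hf l).trans_le ?_
            rcases lt_or_gt_of_ne hl with hjl | hjl <;>
              have := Nat.mul_le_mul_left P (Nat.succ_le_of_lt hjl) <;>
              rw [Nat.mul_succ] at this <;> omega
          · rfl
        · intro hj
          simp [notMem_support_iff.mp hj]
    _ = 0 := by rw [h, coeff_zero]

theorem natDegree_coeff_mul_le {f g : K[X][Y]} {m n : ℕ} (hf : ∀ j, (f.coeff j).natDegree ≤ m)
    (hg : ∀ j, (g.coeff j).natDegree ≤ n) (j : ℕ) : ((f * g).coeff j).natDegree ≤ m + n := by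
  rw [coeff_mul]
  exact natDegree_sum_le_of_forall_le _ _ fun _ _ =>
    natDegree_mul_le.trans (add_le_add (hf _) (hg _))

variable {p s a e : ℕ} [Fact p.Prime] [CharP K p]

/- Squaring turns `D ^ (a + 1)` into `D * D ^ P`, and `D ^ P` is the value at `Y = X ^ P` of a
polynomial with constant coefficients; so the relation `U ^ 2 = D * D ^ P * V ^ 2` has degree
below `P` in `x` and lifts to `K[X][Y]`. -/
theorem eq_zero_of_eval_add_pow_mul_eval_eq_zero (hP : p ^ s = 2 * a + 1) (hae : e ≤ a) {D : K[X]}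
    (hD : D.Monic) (hdeg : D.natDegree = 2 * e) (hsq : ∀ u n : K[X], u ^ 2 = D * n ^ 2 → n = 0)
    {U V : K[X][Y]} (hU : ∀ j, (U.coeff j).natDegree ≤ a)
    (hV : ∀ j, (V.coeff j).natDegree ≤ a - e)
    (h : eval (X ^ p ^ s) U + D ^ (a + 1) * eval (X ^ p ^ s) V = 0) : U = 0 ∧ V = 0 := by
  let D' : K[X][Y] := (D.map (iterateFrobenius K p s)).map C
  have hD'monic : D'.Monic := (hD.map _).map _
  have hD'eval : eval (X ^ p ^ s) D' = D ^ p ^ s := by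
    rw [← map_iterateFrobenius_expand p D s, map_expand, eval_map, expand_eq_comp_X_pow]
    rfl
  have hlift : U ^ 2 - C D * D' * V ^ 2 = 0 := by
    apply eq_zero_of_eval_X_pow_eq_zero (P := p ^ s)
    · intro j
      have hCD (j : ℕ) : ((C D : K[X][Y]).coeff j).natDegree ≤ 2 * e := by
        rw [coeff_C]
        split_ifs
        · exact hdeg.le
        · simp
      have hD'coeff (j : ℕ) : (D'.coeff j).natDegree ≤ 0 := by simp [D']
      have hU2 := natDegree_coeff_mul_le hU hU j
      have hV2 := natDegree_coeff_mul_le (natDegree_coeff_mul_le hCD hD'coeff)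
        (natDegree_coeff_mul_le hV hV) j
      rw [← pow_two] at hU2 hV2
      rw [coeff_sub, hP]
      refine Nat.lt_succ_of_le ((natDegree_sub_le _ _).trans (max_le ?_ ?_)) <;> omega
    · rw [eval_sub, eval_pow, eval_mul, eval_mul, eval_C, eval_pow, hD'eval,
        eq_neg_of_add_eq_zero_left h, hP]
      ring
  have hV0 : V = 0 := by
    rw [← leadingCoeff_eq_zero]
    apply hsq U.leadingCoeff
    simpa only [leadingCoeff_mul, leadingCoeff_pow, leadingCoeff_C, hD'monic.leadingCoeff, mul_one]
      using congrArg leadingCoeff (sub_eq_zero.mp hlift)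
  refine ⟨pow_eq_zero_iff two_ne_zero |>.mp ?_, hV0⟩
  simpa only [hV0, ne_eq, OfNat.ofNat_ne_zero, not_false_eq_true, zero_pow, mul_zero, sub_zero]
    using hlift

theorem exists_hasBidegreeLE_eval_add_pow_mul_eval_eq_zero {P a e : ℕ} (hP : P = 2 * a + 1)
    (hae : e ≤ a) {D : K[X]} (hD : D.natDegree ≤ 2 * e) :
    ∃ c d : K[X][Y], HasBidegreeLE c (a + e) a ∧ HasBidegreeLE d a (a - e) ∧ (c ≠ 0 ∨ d ≠ 0) ∧
      eval (X ^ P) c + D ^ (a + 1) * eval (X ^ P) d = 0 := by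
  let ev : K[X][Y] →ₗ[K] K[X] := ((aeval (X ^ P : K[X])).restrictScalars K).toLinearMap
  let T : (Fin (a + 1) → Fin (a + e + 1) → K) × (Fin (a - e + 1) → Fin (a + 1) → K) →ₗ[K] K[X] :=
    (ev.comp (ofCoeffs _ _)).coprod ((LinearMap.mulLeft K (D ^ (a + 1))).comp
      (ev.comp (ofCoeffs _ _)))
  obtain ⟨f, hf⟩ := Nat.exists_eq_add_of_le hae
  have hTdeg (v) : (T v).natDegree ≤ a + e + P * a := by
    refine (natDegree_add_le _ _).trans (max_le
      ((hasBidegreeLE_ofCoeffs v.1).natDegree_eval_X_pow_le P) ?_)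
    refine natDegree_mul_le.trans ((add_le_add (natDegree_pow_le_of_le _ hD)
      ((hasBidegreeLE_ofCoeffs v.2).natDegree_eval_X_pow_le P)).trans ?_)
    rw [hf, Nat.add_sub_cancel_left, hP, hf]
    linarith
  obtain ⟨⟨c, d⟩, hcd, hT⟩ := exists_ne_zero_eq_zero_of_natDegree_le T hTdeg (by
    simp only [Module.finrank_prod, Module.finrank_pi_fintype, Module.finrank_self,
      Finset.sum_const, Finset.card_univ, Fintype.card_fin, smul_eq_mul, mul_one]
    rw [hf, Nat.add_sub_cancel_left, hP, hf]
    nlinarith)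
  refine ⟨_, _, hasBidegreeLE_ofCoeffs c, hasBidegreeLE_ofCoeffs d, ?_, hT⟩
  rw [(map_ne_zero_iff _ (ofCoeffs_injective _ _)), (map_ne_zero_iff _ (ofCoeffs_injective _ _))]
  exact not_and_or.mp fun h => hcd (Prod.ext h.1 h.2)

theorem eval_eval_X_pow (P : ℕ) (f : K[X][Y]) (y : K) :
    eval y (eval (X ^ P) f) = f.evalEval y (y ^ P) := by
  rw [← map_evalRingHom_eval, eval_map, ← coe_evalRingHom, ← eval₂_id, hom_eval₂, RingHom.comp_id,
    coe_evalRingHom, eval_pow, eval_X]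

theorem map_eval_eval_map_swap {P : ℕ} {φ : K →+* K} (hφ : ∀ x, φ x = x ^ P)
    (hφφ : ∀ x, φ (φ x) = x) (f : K[X][Y]) (y : K) :
    φ (eval y (eval (X ^ P) ((swap f).map (mapRingHom φ)))) = eval y (eval (X ^ P) f) := by
  have hmap : ((swap f).map (mapRingHom φ)).map (mapRingHom φ) = swap f := by
    ext
    simp [hφφ]
  rw [eval_eval_X_pow, eval_eval_X_pow, ← map_mapRingHom_evalEval, hmap, ← hφ, hφφ,
    ← coe_aevalAeval_eq_evalEval, aevalAeval_swap, coe_aevalAeval_eq_evalEval]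

/- Applying `φ` exchanges `y` and `y ^ P`, and it fixes `D(y) ^ (a + 1) = z ^ (P + 1)` when
`D(y) = z ^ 2`. -/
theorem eval_swap_add_pow_mul_swap_eq_zero {P a : ℕ} (hP : P = 2 * a + 1) {φ : K →+* K}
    (hφ : ∀ x, φ x = x ^ P) (hφφ : ∀ x, φ (φ x) = x) {D : K[X]} {c d : K[X][Y]}
    (hrel : eval (X ^ P) c + D ^ (a + 1) * eval (X ^ P) d = 0) {y : K}
    (hy : IsSquare (D.eval y)) :
    eval y (eval (X ^ P) ((swap c).map (mapRingHom φ)) +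
      D ^ (a + 1) * eval (X ^ P) ((swap d).map (mapRingHom φ))) = 0 := by
  obtain ⟨z, hz⟩ := hy
  have hfix : φ (eval y (D ^ (a + 1))) = eval y (D ^ (a + 1)) := by
    rw [eval_pow, hz, ← pow_two, ← pow_mul, show 2 * (a + 1) = P + 1 by omega, pow_succ,
      map_mul, ← hφ, hφφ, mul_comm]
  apply φ.injective
  rw [map_zero, eval_add, eval_mul, map_add, map_mul, map_eval_eval_map_swap hφ hφφ,
    map_eval_eval_map_swap hφ hφφ, hfix, ← eval_mul, ← eval_add, hrel, eval_zero]

theorem two_mul_card_isSquare_eval_lt [Fintype K] [DecidableEq K] (hp : p ≠ 2)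
    (hcard : Fintype.card K = (p ^ s) ^ 2) (he : 2 * e < p ^ s) {D : K[X]} (hD : D.Monic)
    (hdeg : D.natDegree = 2 * e) (hsq : ∀ u n : K[X], u ^ 2 = D * n ^ 2 → n = 0) :
    2 * (Finset.univ.filter fun y : K => IsSquare (D.eval y)).card <
      (p ^ s) ^ 2 + 2 * e * p ^ s := by
  obtain ⟨a, hP⟩ := ((Fact.out : p.Prime).odd_of_ne_two hp).pow (n := s)
  have hae : e ≤ a := by omega
  let φ : K →+* K := iterateFrobenius K p s
  have hφ (x : K) : φ x = x ^ p ^ s := rfl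
  have hφφ (x : K) : φ (φ x) = x := by
    rw [hφ, hφ, ← pow_mul, ← pow_two, ← hcard, FiniteField.pow_card]
  obtain ⟨c, d, hc, hd, hcd, hrel⟩ :=
    exists_hasBidegreeLE_eval_add_pow_mul_eval_eq_zero hP hae hdeg.le
  let U : K[X][Y] := (swap c).map (mapRingHom φ)
  let V : K[X][Y] := (swap d).map (mapRingHom φ)
  have hU : HasBidegreeLE U a (a + e) := hc.swap.map_mapRingHom φ
  have hV : HasBidegreeLE V (a - e) a := hd.swap.map_mapRingHom φ
  let A : K[X] := eval (X ^ p ^ s) U + D ^ (a + 1) * eval (X ^ p ^ s) V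
  have hA0 : A ≠ 0 := fun h => by
    obtain ⟨hU0, hV0⟩ := eq_zero_of_eval_add_pow_mul_eval_eq_zero hP hae hD hdeg hsq
      hU.natDegree_coeff_le hV.natDegree_coeff_le h
    have hinj : Function.Injective (mapRingHom φ) := map_injective φ φ.injective
    have hzero {g : K[X][Y]} (hg : (swap g).map (mapRingHom φ) = 0) : g = 0 :=
      (map_eq_zero_iff _ swap.injective).mp ((Polynomial.map_eq_zero_iff hinj).mp hg)
    exact hcd.elim (· (hzero hU0)) (· (hzero hV0))
  have hAdeg : A.natDegree ≤ a + p ^ s * (a + e) := by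
    refine (natDegree_add_le _ _).trans (max_le (hU.natDegree_eval_X_pow_le _) ?_)
    refine natDegree_mul_le.trans ((add_le_add (natDegree_pow_le_of_le _ hdeg.le)
      (hV.natDegree_eval_X_pow_le _)).trans ?_)
    obtain ⟨f, rfl⟩ := Nat.exists_eq_add_of_le hae
    rw [Nat.add_sub_cancel_left, hP]
    linarith
  have hle : (Finset.univ.filter fun y : K => IsSquare (D.eval y)).card ≤ A.natDegree :=
    card_le_degree_of_subset_roots fun y hy =>
      (mem_roots hA0).mpr
        (eval_swap_add_pow_mul_swap_eq_zero hP hφ hφφ hrel (Finset.mem_filter.mp hy).2)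
  rw [hP] at hAdeg ⊢
  nlinarith

end Stepanov

section ArtinSchreier

variable {K : Type*} [Field K]

theorem natDegree_X_pow_sub_X_add_C {q : ℕ} (hq : 1 < q) (b : K) :
    (X ^ q - X + C b : K[X]).natDegree = q := by
  rw [natDegree_add_C, natDegree_sub_eq_left_of_natDegree_lt, natDegree_X_pow]
  rwa [natDegree_X, natDegree_X_pow]

theorem monic_X_pow_sub_X_add_C {q : ℕ} (hq : 1 < q) (b : K) :
    (X ^ q - X + C b : K[X]).Monic := by
  rw [sub_add]
  refine (monic_X_pow q).sub_of_left ((degree_X_sub_C_le b).trans_lt ?_)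
  rw [degree_X_pow]
  exact_mod_cast hq

theorem eq_zero_of_sq_eq_sq_sub_C_mul_sq {E : K[X]} {c : K} (htwo_ne : (2 : K) ≠ 0) (hc : c ≠ 0)
    (hE : E.natDegree ≠ 0) (u n : K[X]) (h : u ^ 2 = (E ^ 2 - C c) * n ^ 2) : n = 0 := by
  by_contra hn
  obtain ⟨s, rfl⟩ : n ∣ u := (UniqueFactorizationMonoid.pow_dvd_pow_iff_dvd two_ne_zero).mp
    ⟨E ^ 2 - C c, by rw [h, mul_comm]⟩
  have hs : (E - s) * (E + s) = C c := by
    have hs2 : s ^ 2 = E ^ 2 - C c := by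
      apply mul_left_cancel₀ (pow_ne_zero 2 hn)
      rw [← mul_pow, h, mul_comm]
    linear_combination -hs2
  obtain ⟨hsub, hadd⟩ := IsUnit.mul_iff.mp (hs ▸ isUnit_C.mpr hc.isUnit)
  have hsum : (E - s + (E + s)).natDegree = 0 := by
    refine Nat.le_zero.mp ((natDegree_add_le _ _).trans ?_)
    rw [natDegree_eq_zero_of_isUnit hsub, natDegree_eq_zero_of_isUnit hadd, max_self]
  have htwo : E - s + (E + s) = C 2 * E := by rw [map_ofNat]; ring
  exact hE (by rwa [htwo, natDegree_C_mul htwo_ne] at hsum)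

theorem add_div_eq_add_div_iff {β x w : Kˣ} :
    (x : K) + β / x = w + β / w ↔ w = x ∨ w = β / x := by
  have hx := x.ne_zero
  have hw := w.ne_zero
  have hfactor : (x : K) + β / x = w + β / w ↔ ((w : K) - x) * (w * x - β) = 0 := by
    field_simp
    constructor <;> intro h <;> linear_combination -h
  rw [hfactor, mul_eq_zero, sub_eq_zero, sub_eq_zero, eq_div_iff_mul_eq', Units.ext_iff,
    Units.ext_iff, Units.val_mul]

variable [Fintype K] [DecidableEq K]

/-- The number of affine points of the curve `y ^ q - y + b = x + β / x`, whose average against an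
additive character trivial on all `y ^ q - y` is a Kloosterman sum with parameter `β`. -/
noncomputable def artinSchreierCard (q : ℕ) (β : Kˣ) (b : K) : ℕ :=
  (Finset.univ.filter fun v : K × Kˣ =>
    b = (v.2 : K) + (β : K) / (v.2 : K) - (v.1 ^ q - v.1)).card

/-- The discriminant of the equation `x + β / x = E(y)` is `E(y) ^ 2 - 4 β`. -/
theorem artinSchreierCard_le_two_mul (q : ℕ) (β : Kˣ) (b : K) :
    artinSchreierCard q β b ≤ 2 * (Finset.univ.filter fun y : K =>
      IsSquare (((X ^ q - X + C b) ^ 2 - C (4 * (β : K)) : K[X]).eval y)).card := by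
  refine Finset.card_le_mul_card_image_of_maps_to (f := Prod.fst) ?_ 2 fun y _ => ?_
  · rintro ⟨y, x⟩ h
    simp only [Finset.mem_filter, Finset.mem_univ, true_and] at h ⊢
    refine ⟨(x : K) - β / x, ?_⟩
    have hx := x.ne_zero
    simp only [eval_sub, eval_pow, eval_add, eval_X, eval_C, h]
    field_simp
    ring
  · rcases Finset.eq_empty_or_nonempty ((Finset.univ.filter fun v : K × Kˣ =>
        b = (v.2 : K) + (β : K) / (v.2 : K) - (v.1 ^ q - v.1)).filter fun v => v.1 = y)
      with hempty | ⟨⟨_, x⟩, hx⟩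
    · rw [hempty, Finset.card_empty]
      exact Nat.zero_le 2
    · refine (Finset.card_le_card (t := {(y, x), (y, β / x)}) ?_).trans Finset.card_le_two
      simp only [Finset.mem_filter, Finset.mem_univ, true_and] at hx
      obtain ⟨hx, rfl⟩ := hx
      rintro ⟨_, w⟩ hw
      simp only [Finset.mem_filter, Finset.mem_univ, true_and] at hw
      obtain ⟨hw, rfl⟩ := hw
      simpa only [Finset.mem_insert, Finset.mem_singleton, Prod.mk.injEq, true_and] using
        add_div_eq_add_div_iff.mp (by linear_combination hw - hx)

theorem artinSchreierCard_le {p s q : ℕ} [Fact p.Prime] [CharP K p] (hp : p ≠ 2)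
    (hcard : Fintype.card K = (p ^ s) ^ 2) (hq : 1 < q) (hqs : 2 * q < p ^ s) (β : Kˣ) (b : K) :
    artinSchreierCard q β b ≤ Fintype.card K + 2 * q * p ^ s := by
  have htwo_ne : (2 : K) ≠ 0 := Ring.two_ne_zero (by rwa [ringChar.eq K p])
  have hfour_ne : 4 * (β : K) ≠ 0 := by
    rw [show (4 : K) = 2 * 2 by norm_num]
    exact mul_ne_zero (mul_ne_zero htwo_ne htwo_ne) β.ne_zero
  have hE : (X ^ q - X + C b : K[X]).Monic := monic_X_pow_sub_X_add_C hq b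
  have hEdeg : (X ^ q - X + C b : K[X]).natDegree = q := natDegree_X_pow_sub_X_add_C hq b
  have hE2deg : ((X ^ q - X + C b : K[X]) ^ 2).natDegree = 2 * q := by
    rw [hE.natDegree_pow, hEdeg]
  have hD : ((X ^ q - X + C b) ^ 2 - C (4 * (β : K)) : K[X]).Monic := by
    refine (hE.pow 2).sub_of_left (degree_C_le.trans_lt ?_)
    rw [← natDegree_pos_iff_degree_pos, hE2deg]
    omega
  rw [hcard]
  exact (artinSchreierCard_le_two_mul q β b).trans (two_mul_card_isSquare_eval_lt hp hcard hqs hD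
    (by rw [natDegree_sub_C, hE2deg])
    (eq_zero_of_sq_eq_sq_sub_C_mul_sq htwo_ne hfour_ne (by omega))).le

theorem sum_artinSchreierCard_mul {R : Type*} [CommSemiring R] (q : ℕ) (β : Kˣ) (f : K → R) :
    ∑ b, (artinSchreierCard q β b : R) * f b =
      ∑ v : K × Kˣ, f ((v.2 : K) + (β : K) / (v.2 : K) - (v.1 ^ q - v.1)) := by
  simp only [artinSchreierCard, Finset.card_filter, Nat.cast_sum, Finset.sum_mul]
  rw [Finset.sum_comm]
  refine Finset.sum_congr rfl fun v _ => ?_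
  simp

/-- Subtracting the constant `B` from the weights does not change the sum, by orthogonality. -/
theorem norm_sum_mul_addChar_le {G : Type*} [AddCommGroup G] [Fintype G] {Ψ : AddChar G ℂ}
    (hΨ : Ψ ≠ 1) {w : G → ℝ} {B : ℝ} (hw : ∀ b, w b ≤ B) :
    ‖∑ b, (w b : ℂ) * Ψ b‖ ≤ ∑ b, (B - w b) := by
  have hsum : ∑ b, (w b : ℂ) * Ψ b = -∑ b, ((B - w b : ℝ) : ℂ) * Ψ b := by
    simp only [Complex.ofReal_sub, sub_mul, Finset.sum_sub_distrib, ← Finset.mul_sum,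
      AddChar.sum_eq_zero_of_ne_one hΨ, mul_zero, zero_sub, neg_neg]
  rw [hsum, norm_neg]
  refine norm_sum_le_of_le _ fun b _ => ?_
  rw [norm_mul, Complex.norm_real, AddChar.norm_apply, mul_one,
    Real.norm_of_nonneg (sub_nonneg.mpr (hw b))]

theorem sum_artinSchreierCard (q : ℕ) (β : Kˣ) :
    ∑ b, (artinSchreierCard q β b : ℝ) = Fintype.card K * (Fintype.card K - 1) := by
  have h := sum_artinSchreierCard_mul q β fun _ => (1 : ℝ)
  simp only [mul_one, Finset.sum_const, Finset.card_univ, Fintype.card_prod, nsmul_eq_mul,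
    Fintype.card_units] at h
  rw [h, Nat.cast_mul, Nat.cast_pred Fintype.card_pos]

theorem norm_sum_kloosterman_le {p s q : ℕ} [Fact p.Prime] [CharP K p] (hp : p ≠ 2)
    (hcard : Fintype.card K = (p ^ s) ^ 2) (hq : 1 < q) (hqs : 2 * q < p ^ s) (β : Kˣ)
    {Ψ : AddChar K ℂ} (hΨ : Ψ ≠ 1) (hΨq : ∀ y, Ψ (y ^ q - y) = 1) :
    ‖∑ x : Kˣ, Ψ ((x : K) + (β : K) / (x : K))‖ ≤ 2 * q * (p : ℝ) ^ s + 1 := by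
  have hpos : (0 : ℝ) < Fintype.card K := mod_cast Fintype.card_pos
  have hsum : ∑ b, ((artinSchreierCard q β b : ℝ) : ℂ) * Ψ b =
      (Fintype.card K : ℂ) * ∑ x : Kˣ, Ψ ((x : K) + (β : K) / (x : K)) := by
    simp only [Complex.ofReal_natCast, sum_artinSchreierCard_mul, Fintype.sum_prod_type,
      AddChar.map_sub_eq_div, hΨq, div_one, Finset.sum_const, Finset.card_univ, nsmul_eq_mul]
  refine le_of_mul_le_mul_left ?_ hpos
  calc (Fintype.card K : ℝ) * ‖∑ x : Kˣ, Ψ ((x : K) + (β : K) / (x : K))‖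
      = ‖∑ b, ((artinSchreierCard q β b : ℝ) : ℂ) * Ψ b‖ := by
        rw [hsum, norm_mul, Complex.norm_natCast]
    _ ≤ ∑ b, ((Fintype.card K + 2 * q * p ^ s : ℕ) - (artinSchreierCard q β b : ℝ)) :=
        norm_sum_mul_addChar_le hΨ fun b =>
          mod_cast artinSchreierCard_le hp hcard hq hqs β b
    _ = Fintype.card K * (2 * q * (p : ℝ) ^ s + 1) := by
        rw [Finset.sum_sub_distrib, sum_artinSchreierCard, Finset.sum_const, Finset.card_univ,
          nsmul_eq_mul]
        push_cast
        ring

end ArtinSchreier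

section MonicPolynomials

variable (F : Type*) [Field F] [Finite F]

theorem finite_setOf_monic_natDegree_eq (d : ℕ) :
    {f : F[X] | f.Monic ∧ f.natDegree = d}.Finite := by
  have : Finite (degreeLT F d) := Finite.of_equiv _ (degreeLTEquiv F d).toEquiv.symm
  exact Set.finite_coe_iff.mp (Finite.of_equiv _ (monicEquivDegreeLT (R := F) d).symm)

/-- The monic polynomials of degree `d` over a finite field. -/
noncomputable def monicsOfDegree (d : ℕ) : Finset F[X] :=
  (finite_setOf_monic_natDegree_eq F d).toFinset

variable {F}

@[simp] theorem mem_monicsOfDegree {d : ℕ} {f : F[X]} :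
    f ∈ monicsOfDegree F d ↔ f.Monic ∧ f.natDegree = d := by
  simp [monicsOfDegree]

variable (F) in
open Classical in
/-- The monic irreducible polynomials of degree at most `m` over a finite field. -/
noncomputable def monicIrreducibles (m : ℕ) : Finset F[X] :=
  ((Finset.range (m + 1)).biUnion (monicsOfDegree F)).filter Irreducible

@[simp] theorem mem_monicIrreducibles {m : ℕ} {f : F[X]} :
    f ∈ monicIrreducibles F m ↔ f.Monic ∧ Irreducible f ∧ f.natDegree ≤ m := by
  simp only [monicIrreducibles, Finset.mem_filter, Finset.mem_biUnion, Finset.mem_range,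
    mem_monicsOfDegree, Nat.lt_succ_iff]
  constructor
  · rintro ⟨⟨_, hd, hmonic, rfl⟩, hirr⟩
    exact ⟨hmonic, hirr, hd⟩
  · rintro ⟨hmonic, hirr, hd⟩
    exact ⟨⟨_, hd, hmonic, rfl⟩, hirr⟩

theorem monicIrreducibles_filter_dvd {k m : ℕ} (hk : k ≠ 0) (hkm : k ≤ m) :
    (monicIrreducibles F m).filter (·.natDegree ∣ k) =
      (monicIrreducibles F k).filter (·.natDegree ∣ k) := by
  ext P
  simp only [Finset.mem_filter, mem_monicIrreducibles]
  constructor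
  · rintro ⟨⟨hmonic, hirr, -⟩, hd⟩
    exact ⟨⟨hmonic, hirr, Nat.le_of_dvd (Nat.pos_of_ne_zero hk) hd⟩, hd⟩
  · rintro ⟨⟨hmonic, hirr, hle⟩, hd⟩
    exact ⟨⟨hmonic, hirr, hle.trans hkm⟩, hd⟩

open UniqueFactorizationMonoid in
theorem natDegree_eq_sum_multiplicity {f : F[X]} (hf : f.Monic) :
    f.natDegree = ∑ P ∈ monicIrreducibles F f.natDegree, multiplicity P f * P.natDegree := by
  classical
  have hmonic (P : F[X]) (hP : P ∈ normalizedFactors f) : P.Monic := by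
    rw [← normalize_normalized_factor P hP]
    exact monic_normalize (irreducible_of_normalized_factor P hP).ne_zero
  have hcount (P : F[X]) (hP : P ∈ monicIrreducibles F f.natDegree) :
      multiplicity P f = (normalizedFactors f).count P := by
    obtain ⟨hPm, hPi, -⟩ := mem_monicIrreducibles.mp hP
    have := emultiplicity_eq_count_normalizedFactors hPi hf.ne_zero
    rw [hPm.normalize_eq_self] at this
    exact multiplicity_eq_of_emultiplicity_eq_some this
  have hsub : (normalizedFactors f).toFinset ⊆ monicIrreducibles F f.natDegree := fun P hP => by
    rw [Multiset.mem_toFinset] at hP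
    exact mem_monicIrreducibles.mpr ⟨hmonic P hP, irreducible_of_normalized_factor P hP,
      natDegree_le_of_dvd (dvd_of_mem_normalizedFactors hP) hf.ne_zero⟩
  calc f.natDegree = ((normalizedFactors f).map natDegree).sum := by
        rw [← natDegree_multiset_prod_of_monic _ hmonic, prod_normalizedFactors_eq hf.ne_zero,
          hf.normalize_eq_self]
    _ = ∑ P ∈ (normalizedFactors f).toFinset, (normalizedFactors f).count P * P.natDegree := by
        simp only [Finset.sum_multiset_map_count, smul_eq_mul]
    _ = ∑ P ∈ monicIrreducibles F f.natDegree, (normalizedFactors f).count P * P.natDegree :=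
        Finset.sum_subset hsub fun P _ hP => by
          rw [Multiset.count_eq_zero_of_notMem (mt Multiset.mem_toFinset.mpr hP), zero_mul]
    _ = ∑ P ∈ monicIrreducibles F f.natDegree, multiplicity P f * P.natDegree :=
        Finset.sum_congr rfl fun P hP => by rw [hcount P hP]

open Classical in
theorem multiplicity_eq_card_filter {F : Type*} [Field F] {f P : F[X]} (hf : f ≠ 0)
    (hP : Irreducible P) :
    multiplicity P f = ((Finset.Icc 1 f.natDegree).filter fun k =>
      P.natDegree ∣ k ∧ P ^ (k / P.natDegree) ∣ f).card := by
  have hpos : 0 < P.natDegree := hP.natDegree_pos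
  have hdvd (r : ℕ) : P ^ r ∣ f ↔ r ≤ multiplicity P f :=
    (FiniteMultiplicity.of_not_isUnit hP.not_isUnit hf).pow_dvd_iff_le_multiplicity
  have himage : ((Finset.Icc 1 f.natDegree).filter fun k =>
      P.natDegree ∣ k ∧ P ^ (k / P.natDegree) ∣ f) =
        (Finset.Icc 1 (multiplicity P f)).image (P.natDegree * ·) := by
    ext k
    simp only [Finset.mem_filter, Finset.mem_Icc, Finset.mem_image]
    constructor
    · rintro ⟨⟨hk, -⟩, ⟨r, rfl⟩, hr⟩
      rw [Nat.mul_div_cancel_left _ hpos, hdvd] at hr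
      exact ⟨r, ⟨Nat.pos_of_mul_pos_left hk, hr⟩, rfl⟩
    · rintro ⟨r, ⟨hr, hle⟩, rfl⟩
      have hle' := natDegree_le_of_dvd ((hdvd r).mpr hle) hf
      rw [natDegree_pow, mul_comm] at hle'
      rw [Nat.mul_div_cancel_left _ hpos]
      exact ⟨⟨Nat.mul_pos hpos hr, hle'⟩, dvd_mul_right _ _, (hdvd r).mpr hle⟩
  rw [himage, Finset.card_image_of_injective _ fun _ _ h => Nat.eq_of_mul_eq_mul_left hpos h,
    Nat.card_Icc, Nat.add_sub_cancel]

theorem add_C_mul_X_pow_mem_monicsOfDegree {f : F[X]} {m k : ℕ} (c : F) (hk : k < m)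
    (hf : f ∈ monicsOfDegree F m) : f + C c * X ^ k ∈ monicsOfDegree F m := by
  obtain ⟨hmonic, hdeg⟩ := mem_monicsOfDegree.mp hf
  have hlt : (C c * X ^ k).degree < f.degree := by
    refine (degree_C_mul_X_pow_le _ _).trans_lt ?_
    rw [degree_eq_natDegree hmonic.ne_zero, hdeg]
    exact_mod_cast hk
  exact mem_monicsOfDegree.mpr ⟨hmonic.add_of_left hlt,
    (natDegree_add_eq_left_of_degree_lt hlt).trans hdeg⟩

end MonicPolynomials

section EulerProduct

variable {F : Type*} [Field F] {R : Type*} [CommRing R] {Λ : F[X] → R}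

/-- Complete multiplicativity of a function on the monic polynomials over a field; the values of
`Λ` at the other polynomials are arbitrary. -/
structure IsMonicMultiplicative (Λ : F[X] → R) : Prop where
  map_one : Λ 1 = 1
  map_mul : ∀ ⦃f g : F[X]⦄, f.Monic → g.Monic → Λ (f * g) = Λ f * Λ g

theorem IsMonicMultiplicative.map_pow (hΛ : IsMonicMultiplicative Λ) {f : F[X]} (hf : f.Monic)
    (r : ℕ) : Λ (f ^ r) = Λ f ^ r := by
  induction r with
  | zero => simp only [pow_zero, hΛ.map_one]
  | succ r ih => rw [pow_succ, hΛ.map_mul (hf.pow r) hf, ih, pow_succ]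

variable [Finite F]

open Classical in
theorem IsMonicMultiplicative.sum_filter_dvd (hΛ : IsMonicMultiplicative Λ) {g : F[X]}
    (hg : g.Monic) {m : ℕ} (hgm : g.natDegree ≤ m) :
    ∑ f ∈ (monicsOfDegree F m).filter (g ∣ ·), Λ f =
      Λ g * ∑ f ∈ monicsOfDegree F (m - g.natDegree), Λ f := by
  have himage : (monicsOfDegree F m).filter (g ∣ ·) =
      (monicsOfDegree F (m - g.natDegree)).image (g * ·) := by
    ext f
    simp only [Finset.mem_filter, Finset.mem_image, mem_monicsOfDegree]
    constructor
    · rintro ⟨⟨hf, hdeg⟩, h, rfl⟩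
      have hh := hg.of_mul_monic_left hf
      rw [hg.natDegree_mul hh] at hdeg
      exact ⟨h, ⟨hh, by omega⟩, rfl⟩
    · rintro ⟨h, ⟨hh, hdeg⟩, rfl⟩
      rw [hg.natDegree_mul hh]
      exact ⟨⟨hg.mul hh, by omega⟩, dvd_mul_right _ _⟩
  rw [himage, Finset.sum_image fun a _ b _ h => mul_left_cancel₀ hg.ne_zero h, Finset.mul_sum]
  exact Finset.sum_congr rfl fun h hh => hΛ.map_mul hg (mem_monicsOfDegree.mp hh).1

open Classical in
/-- The coefficient of `T ^ k` in `T L'(T) / L(T)`, where `L(T) = ∏ P, (1 - Λ(P) T ^ deg P)⁻¹` is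
the Euler product of `Λ` over the monic irreducible polynomials. -/
noncomputable def primePowerSum (Λ : F[X] → R) (k : ℕ) : R :=
  ∑ P ∈ (monicIrreducibles F k).filter (·.natDegree ∣ k),
    (P.natDegree : R) * Λ P ^ (k / P.natDegree)

open Classical in
theorem natDegree_mul_eq_sum_primePower (Λ : F[X] → R) {f : F[X]} (hf : f.Monic) :
    (f.natDegree : R) * Λ f = ∑ k ∈ Finset.Icc 1 f.natDegree,
      ∑ P ∈ (monicIrreducibles F k).filter (·.natDegree ∣ k),
        (P.natDegree : R) * if P ^ (k / P.natDegree) ∣ f then Λ f else 0 := by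
  have hextend : ∀ k ∈ Finset.Icc 1 f.natDegree,
      ∑ P ∈ (monicIrreducibles F k).filter (·.natDegree ∣ k),
        (P.natDegree : R) * (if P ^ (k / P.natDegree) ∣ f then Λ f else 0) =
      ∑ P ∈ monicIrreducibles F f.natDegree,
        if P.natDegree ∣ k ∧ P ^ (k / P.natDegree) ∣ f then (P.natDegree : R) * Λ f else 0 := by
    intro k hk
    obtain ⟨hk₁, hkf⟩ := Finset.mem_Icc.mp hk
    rw [← monicIrreducibles_filter_dvd (Nat.one_le_iff_ne_zero.mp hk₁) hkf, Finset.sum_filter]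
    simp only [ite_and, mul_ite, mul_zero]
  conv_lhs => rw [natDegree_eq_sum_multiplicity hf]
  rw [Finset.sum_congr rfl hextend, Finset.sum_comm, Nat.cast_sum, Finset.sum_mul]
  refine Finset.sum_congr rfl fun P hP => ?_
  rw [multiplicity_eq_card_filter hf.ne_zero (mem_monicIrreducibles.mp hP).2.1,
    ← Finset.sum_filter, Finset.sum_const, nsmul_eq_mul, Nat.cast_mul, mul_assoc]

theorem IsMonicMultiplicative.natCast_mul_sum (hΛ : IsMonicMultiplicative Λ) (m : ℕ) :
    (m : R) * ∑ f ∈ monicsOfDegree F m, Λ f =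
      ∑ k ∈ Finset.Icc 1 m, primePowerSum Λ k * ∑ f ∈ monicsOfDegree F (m - k), Λ f := by
  classical
  have hpointwise : ∀ f ∈ monicsOfDegree F m, (m : R) * Λ f = ∑ k ∈ Finset.Icc 1 m,
      ∑ P ∈ (monicIrreducibles F k).filter (·.natDegree ∣ k),
        (P.natDegree : R) * if P ^ (k / P.natDegree) ∣ f then Λ f else 0 := fun f hf => by
    obtain ⟨hmonic, rfl⟩ := mem_monicsOfDegree.mp hf
    exact natDegree_mul_eq_sum_primePower Λ hmonic
  rw [Finset.mul_sum, Finset.sum_congr rfl hpointwise, Finset.sum_comm]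
  refine Finset.sum_congr rfl fun k hk => ?_
  rw [Finset.sum_comm, primePowerSum, Finset.sum_mul]
  refine Finset.sum_congr rfl fun P hP => ?_
  rw [Finset.mem_filter, mem_monicIrreducibles] at hP
  obtain ⟨⟨hPm, -, -⟩, hd⟩ := hP
  have hdeg : (P ^ (k / P.natDegree)).natDegree = k := by
    rw [natDegree_pow, Nat.div_mul_cancel hd]
  have hdvd := hΛ.sum_filter_dvd (hPm.pow (k / P.natDegree))
    (hdeg.le.trans (Finset.mem_Icc.mp hk).2)
  rw [← Finset.mul_sum, ← Finset.sum_filter, hdvd, hdeg, hΛ.map_pow hPm, mul_assoc]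

end EulerProduct

section Extension

variable {F : Type*} [Field F] [Finite F] {R : Type*} [CommRing R]

theorem splits_map_of_natDegree_dvd_finrank {K : Type*} [Field K] [Finite K] [Algebra F K]
    {P : F[X]} (hP : Irreducible P) (hdvd : P.natDegree ∣ Module.finrank F K) :
    (P.map (algebraMap F K)).Splits := by
  have := Fintype.ofFinite F
  have := Fintype.ofFinite K
  have hcard : Nat.card F ^ Module.finrank F K = Fintype.card K := by
    rw [← Module.natCard_eq_pow_finrank, Nat.card_eq_fintype_card]
  have hX := hP.natDegree_dvd_iff_dvd_X_pow_card_pow_sub_X.mp hdvd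
  rw [hcard] at hX
  exact (FiniteField.isSplittingField_sub K F).splits'.of_dvd
    (Polynomial.map_ne_zero (FiniteField.X_pow_card_sub_X_ne_zero F Fintype.one_lt_card))
    (Polynomial.map_dvd (algebraMap F K) hX)

theorem card_filter_minpoly_eq {K : Type*} [Field K] [Fintype K] [Algebra F K] [DecidableEq F[X]]
    {P : F[X]} (hP : Irreducible P) (hmonic : P.Monic)
    (hdvd : P.natDegree ∣ Module.finrank F K) :
    (Finset.univ.filter fun x : K => minpoly F x = P).card = P.natDegree := by
  classical
  have hroots : (Finset.univ.filter fun x : K => minpoly F x = P) = (P.rootSet K).toFinset := by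
    ext x
    rw [Finset.mem_filter_univ, Set.mem_toFinset, mem_rootSet_of_ne hmonic.ne_zero]
    constructor
    · rintro rfl
      exact minpoly.aeval F x
    · exact fun h => (minpoly.eq_of_irreducible_of_monic hP h hmonic).symm
  rw [hroots, Set.toFinset_card, card_rootSet_eq_natDegree
    (PerfectField.separable_of_irreducible hP) (splits_map_of_natDegree_dvd_finrank hP hdvd)]

theorem sum_minpoly_eq_primePowerSum (Λ : F[X] → R) (K : Type*) [Field K] [Fintype K]
    [Algebra F K] : ∑ x : K, Λ (minpoly F x) ^ (Module.finrank F K / (minpoly F x).natDegree) =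
      primePowerSum Λ (Module.finrank F K) := by
  classical
  have hmem : ∀ x ∈ (Finset.univ : Finset K), minpoly F x ∈
      (monicIrreducibles F (Module.finrank F K)).filter (·.natDegree ∣ Module.finrank F K) := by
    intro x _
    have hx : IsIntegral F x := .of_finite F x
    have hdvd := minpoly.degree_dvd hx
    rw [Finset.mem_filter, mem_monicIrreducibles]
    exact ⟨⟨minpoly.monic hx, minpoly.irreducible hx, Nat.le_of_dvd Module.finrank_pos hdvd⟩, hdvd⟩
  rw [← Finset.sum_fiberwise_of_maps_to hmem, primePowerSum]
  refine Finset.sum_congr rfl fun P hP => ?_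
  rw [Finset.mem_filter, mem_monicIrreducibles] at hP
  obtain ⟨⟨hmonic, hirr, -⟩, hdvd⟩ := hP
  have hconst : ∀ x ∈ Finset.univ.filter fun x : K => minpoly F x = P,
      Λ (minpoly F x) ^ (Module.finrank F K / (minpoly F x).natDegree) =
        Λ P ^ (Module.finrank F K / P.natDegree) :=
    fun x hx => by rw [(Finset.mem_filter.mp hx).2]
  rw [Finset.sum_congr rfl hconst, Finset.sum_const, card_filter_minpoly_eq hirr hmonic hdvd,
    nsmul_eq_mul]

end Extension

section SmallDegree

variable {F : Type*} [Field F] {M : Type*} [AddCommMonoid M]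

theorem natDegree_X_sq_add (b c : F) : (X ^ 2 + C b * X + C c).natDegree = 2 := by
  compute_degree!

theorem monicsOfDegree_zero [Finite F] : monicsOfDegree F 0 = {1} := by
  ext f
  rw [mem_monicsOfDegree, Finset.mem_singleton]
  constructor
  · exact fun hf => hf.1.natDegree_eq_zero.mp hf.2
  · rintro rfl
    exact ⟨monic_one, natDegree_one⟩

variable [Fintype F]

theorem sum_monicsOfDegree_one (Λ : F[X] → M) :
    ∑ f ∈ monicsOfDegree F 1, Λ f = ∑ x : F, Λ (X - C x) := by
  refine (Finset.sum_bij (fun x _ => X - C x) (fun x _ => ?_) (fun x _ y _ h => ?_)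
    (fun f hf => ?_) fun _ _ => rfl).symm
  · exact mem_monicsOfDegree.mpr ⟨monic_X_sub_C x, natDegree_X_sub_C x⟩
  · exact C_injective (sub_right_injective h)
  · obtain ⟨hmonic, hdeg⟩ := mem_monicsOfDegree.mp hf
    exact ⟨-f.coeff 0, Finset.mem_univ _, by
      rw [map_neg, sub_neg_eq_add, ← hmonic.eq_X_add_C hdeg]⟩

theorem sum_monicsOfDegree_two (Λ : F[X] → M) : ∑ f ∈ monicsOfDegree F 2, Λ f =
    ∑ c : F, ∑ b : F, Λ (X ^ 2 + C b * X + C c) := by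
  rw [← Fintype.sum_prod_type']
  refine (Finset.sum_bij (fun x _ => X ^ 2 + C x.2 * X + C x.1) (fun x _ => ?_) ?_
    (fun f hf => ?_) fun _ _ => rfl).symm
  · refine mem_monicsOfDegree.mpr ⟨?_, natDegree_X_sq_add _ _⟩
    rw [Monic, leadingCoeff, natDegree_X_sq_add]
    simp
  · rintro ⟨c, b⟩ _ ⟨c', b'⟩ _ h
    ext
    · simpa using congrArg (coeff · 0) h
    · simpa using congrArg (coeff · 1) h
  · obtain ⟨hmonic, hdeg⟩ := mem_monicsOfDegree.mp hf
    have hlead : f.coeff 2 = 1 := hdeg ▸ hmonic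
    refine ⟨(f.coeff 0, f.coeff 1), Finset.mem_univ _, ?_⟩
    conv_rhs => rw [f.as_sum_range_C_mul_X_pow, hdeg]
    simp only [Finset.sum_range_succ, Finset.sum_range_zero, hlead, map_one]
    ring

end SmallDegree

section KloostermanCharacter

variable {F : Type*} [Field F] [DecidableEq F] {R : Type*} [CommRing R]

/-- The completely multiplicative function on monic polynomials whose `L`-function is that of the
Kloosterman sum: `f ↦ ψ(∑ (x + α / x))`, the sum over the roots `x` of `f`, which Vieta's formulas
express through the coefficients of `f`. It is `0` on the multiples of `X`. -/
noncomputable def kloostermanCharacter (ψ : AddChar F R) (α : Fˣ) (f : F[X]) : R :=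
  if f.coeff 0 = 0 then 0 else ψ (-f.nextCoeff - α * (f.coeff 1 / f.coeff 0))

theorem isMonicMultiplicative_kloostermanCharacter (ψ : AddChar F R) (α : Fˣ) :
    IsMonicMultiplicative (kloostermanCharacter ψ α) where
  map_one := by simp [kloostermanCharacter, nextCoeff, coeff_one]
  map_mul f g hf hg := by
    simp only [kloostermanCharacter, mul_coeff_zero, mul_coeff_one, hf.nextCoeff_mul hg]
    by_cases hf₀ : f.coeff 0 = 0
    · simp [hf₀]
    by_cases hg₀ : g.coeff 0 = 0
    · simp [hg₀]
    simp only [hf₀, hg₀, mul_eq_zero, or_self, if_false, ← AddChar.map_add_eq_mul]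
    congr 1
    field_simp
    ring

theorem kloostermanCharacter_X_sub_C (ψ : AddChar F R) (α x : Fˣ) :
    kloostermanCharacter ψ α (X - C (x : F)) = ψ (x + α / x) := by
  have hcoeff : (X - C (x : F)).coeff 0 ≠ 0 := by simp
  rw [kloostermanCharacter, if_neg hcoeff, nextCoeff_X_sub_C]
  simp only [neg_neg, coeff_sub, coeff_X_one, coeff_C_succ, sub_zero, coeff_X_zero, coeff_C_zero,
    zero_sub, div_neg, mul_neg, mul_one_div, sub_neg_eq_add]

theorem kloostermanCharacter_X_sq_add (ψ : AddChar F R) (α c : Fˣ) (b : F) :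
    kloostermanCharacter ψ α (X ^ 2 + C b * X + C (c : F)) = ψ (b * -(1 + α / c)) := by
  have hcoeff : (X ^ 2 + C b * X + C (c : F)).coeff 0 = (c : F) := by simp
  have hcoeff' : (X ^ 2 + C b * X + C (c : F)).coeff 1 = b := by simp
  rw [kloostermanCharacter, hcoeff, if_neg c.ne_zero, nextCoeff,
    natDegree_X_sq_add, if_neg two_ne_zero, hcoeff']
  congr 1
  ring

section Finite

variable [Finite F]

theorem kloostermanCharacter_add_C_mul_X_pow (ψ : AddChar F R) (α : Fˣ) {f : F[X]}
    {m : ℕ} (hm : 1 < m) (c : F) (hf : f ∈ monicsOfDegree F (m + 1)) :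
    kloostermanCharacter ψ α (f + C (-c) * X ^ m) = ψ c * kloostermanCharacter ψ α f := by
  have hdeg := (mem_monicsOfDegree.mp hf).2
  have hdeg' := (mem_monicsOfDegree.mp
    (add_C_mul_X_pow_mem_monicsOfDegree (-c) m.lt_add_one hf)).2
  have hm₀ : 0 ≠ m := by omega
  simp only [kloostermanCharacter, nextCoeff, hdeg, hdeg', m.add_one_ne_zero, coeff_add,
    coeff_C_mul, coeff_X_pow, hm₀, hm.ne, if_false, if_true, mul_zero, add_zero, mul_one,
    Nat.add_sub_cancel]
  split_ifs with h
  · rw [mul_zero]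
  · rw [← AddChar.map_add_eq_mul]
    congr 1
    ring

theorem sum_monicsOfDegree_kloostermanCharacter_of_three_le [IsDomain R] {ψ : AddChar F R}
    (hψ : ψ ≠ 1) (α : Fˣ) {m : ℕ} (hm : 3 ≤ m) :
    ∑ f ∈ monicsOfDegree F m, kloostermanCharacter ψ α f = 0 := by
  obtain ⟨c, hc⟩ := AddChar.ne_one_iff.mp hψ
  obtain ⟨m, rfl⟩ : ∃ k, m = k + 1 := ⟨m - 1, by omega⟩
  have hmem (b : F) {f : F[X]} (hf : f ∈ monicsOfDegree F (m + 1)) :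
      f + C b * X ^ m ∈ monicsOfDegree F (m + 1) :=
    add_C_mul_X_pow_mem_monicsOfDegree b m.lt_add_one hf
  have hshift : ψ c * ∑ f ∈ monicsOfDegree F (m + 1), kloostermanCharacter ψ α f =
      ∑ f ∈ monicsOfDegree F (m + 1), kloostermanCharacter ψ α f := by
    rw [Finset.mul_sum]
    exact Finset.sum_bij (fun f _ => f + C (-c) * X ^ m) (fun f hf => hmem _ hf)
      (fun f _ g _ h => add_right_cancel h)
      (fun f hf => ⟨f + C c * X ^ m, hmem c hf, by rw [map_neg]; ring⟩)
      fun f hf => (kloostermanCharacter_add_C_mul_X_pow ψ α (by omega) c hf).symm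
  exact (mul_left_eq_self₀.mp hshift).resolve_left hc

end Finite

variable [Fintype F]

theorem sum_monicsOfDegree_one_kloostermanCharacter (ψ : AddChar F R) (α : Fˣ) :
    ∑ f ∈ monicsOfDegree F 1, kloostermanCharacter ψ α f = -kloostermanSum ψ α := by
  have hzero : kloostermanCharacter ψ α (X - C 0) = 0 := by simp [kloostermanCharacter]
  rw [sum_monicsOfDegree_one, kloostermanSum, neg_neg]
  refine (Fintype.sum_of_injective _ Units.val_injective _ _ (fun x hx => ?_) fun x =>
    (kloostermanCharacter_X_sub_C ψ α x).symm).symm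
  obtain rfl : x = 0 := by_contra fun hx₀ => hx ⟨Units.mk0 x hx₀, rfl⟩
  exact hzero

theorem sum_monicsOfDegree_two_kloostermanCharacter [IsDomain R] {ψ : AddChar F R} (hψ : ψ ≠ 1)
    (α : Fˣ) : ∑ f ∈ monicsOfDegree F 2, kloostermanCharacter ψ α f = Fintype.card F := by
  have hunit (c : Fˣ) : ∑ b : F, kloostermanCharacter ψ α (X ^ 2 + C b * X + C (c : F)) =
      if c = -α then (Fintype.card F : R) else 0 := by
    have hiff : -(1 + (α : F) / c) = 0 ↔ c = -α := by
      rw [neg_eq_zero, ← div_self c.ne_zero, ← add_div, div_eq_zero_iff, or_iff_left c.ne_zero,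
        add_eq_zero_iff_eq_neg, Units.ext_iff, Units.val_neg]
    simp only [kloostermanCharacter_X_sq_add]
    rw [AddChar.sum_mulShift _ (AddChar.IsPrimitive.of_ne_one hψ), Nat.cast_ite, Nat.cast_zero]
    simp only [hiff]
  have hzero (b : F) : kloostermanCharacter ψ α (X ^ 2 + C b * X + C 0) = 0 := by
    simp [kloostermanCharacter]
  rw [sum_monicsOfDegree_two, ← Fintype.sum_of_injective _ Units.val_injective _ _ (fun x hx => ?_)
    fun c => (hunit c).symm, Finset.sum_ite_eq', if_pos (Finset.mem_univ _)]
  obtain rfl : x = 0 := by_contra fun hx₀ => hx ⟨Units.mk0 x hx₀, rfl⟩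
  exact Finset.sum_eq_zero fun b _ => hzero b

end KloostermanCharacter

/-- Newton's identities for the two reciprocal roots of `1 - (u + v) T + u v T ^ 2`. -/
theorem eq_neg_add_pow_of_recurrence {R : Type*} [CommRing R] {A S : ℕ → R} {u v : R}
    (hA₀ : A 0 = 1) (hA₁ : A 1 = -(u + v)) (hA₂ : A 2 = u * v) (hA : ∀ m, 3 ≤ m → A m = 0)
    (hrec : ∀ m : ℕ, m * A m = ∑ k ∈ Finset.Icc 1 m, S k * A (m - k)) (m : ℕ) :
    S (m + 1) = -(u ^ (m + 1) + v ^ (m + 1)) := by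
  induction m using Nat.strong_induction_on with
  | _ m ih =>
    match m, ih with
    | 0, _ =>
      have hone := hrec 1
      simp only [Finset.Icc_self, Finset.sum_singleton, Nat.sub_self, hA₀, hA₁] at hone
      linear_combination -hone
    | 1, ih =>
      have htwo := hrec 2
      rw [Finset.sum_Icc_succ_top (by norm_num), Finset.Icc_self, Finset.sum_singleton,
        ih 0 one_pos, Nat.sub_self, show 2 - 1 = 1 from rfl, hA₀, hA₁, hA₂] at htwo
      push_cast at htwo
      linear_combination -htwo
    | n + 2, ih =>
      have hvanish : ∀ k ∈ Finset.Icc 1 n, S k * A (n + 3 - k) = 0 := fun k hk => by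
        rw [hA _ (by have := Finset.mem_Icc.mp hk; omega), mul_zero]
      have hn := hrec (n + 3)
      rw [hA _ (by omega), mul_zero, Finset.sum_Icc_succ_top (by omega),
        Finset.sum_Icc_succ_top (by omega), Finset.sum_Icc_succ_top (by omega),
        Finset.sum_eq_zero hvanish, zero_add, Nat.sub_self, show n + 3 - (n + 1) = 2 by omega,
        show n + 3 - (n + 1 + 1) = 1 by omega, hA₀, hA₁, hA₂, ih n (by omega),
        ih (n + 1) (by omega)] at hn
      linear_combination -hn

theorem primePowerSum_kloostermanCharacter {F R : Type*} [Field F] [Fintype F] [DecidableEq F]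
    [CommRing R] [IsDomain R] {ψ : AddChar F R} (hψ : ψ ≠ 1) (α : Fˣ) {u v : R}
    (hadd : u + v = kloostermanSum ψ α) (hmul : u * v = Fintype.card F) (m : ℕ) :
    primePowerSum (kloostermanCharacter ψ α) (m + 1) = -(u ^ (m + 1) + v ^ (m + 1)) := by
  have hΛ := isMonicMultiplicative_kloostermanCharacter ψ α
  refine eq_neg_add_pow_of_recurrence
    (A := fun m => ∑ f ∈ monicsOfDegree F m, kloostermanCharacter ψ α f) ?_ ?_ ?_
    (fun m => sum_monicsOfDegree_kloostermanCharacter_of_three_le hψ α) hΛ.natCast_mul_sum m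
  · rw [monicsOfDegree_zero, Finset.sum_singleton, hΛ.map_one]
  · rw [sum_monicsOfDegree_one_kloostermanCharacter, hadd]
  · rw [sum_monicsOfDegree_two_kloostermanCharacter hψ, hmul]

section Trace

variable {F K : Type*} [Field F] [Field K] [Algebra F K]

theorem adjoin_simple_inv (x : K) :
    IntermediateField.adjoin F {x⁻¹} = IntermediateField.adjoin F {x} := by
  apply le_antisymm <;> rw [IntermediateField.adjoin_simple_le_iff]
  · exact inv_mem (IntermediateField.mem_adjoin_simple_self F x)
  · simpa only [inv_inv] using inv_mem (IntermediateField.mem_adjoin_simple_self F x⁻¹)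

theorem natDegree_reverse_of_coeff_zero_ne_zero {R : Type*} [Semiring R] {f : R[X]}
    (hf : f.coeff 0 ≠ 0) : f.reverse.natDegree = f.natDegree := by
  rw [reverse_natDegree, natTrailingDegree_eq_zero.mpr (Or.inr hf), Nat.sub_zero]

variable [FiniteDimensional F K]

theorem minpoly_inv {x : K} (hx : x ≠ 0) :
    minpoly F x⁻¹ = C ((minpoly F x).coeff 0)⁻¹ * (minpoly F x).reverse := by
  have hx_int : IsIntegral F x := .of_finite F x
  have hx_int' : IsIntegral F x⁻¹ := .of_finite F x⁻¹
  have hcoeff := minpoly.coeff_zero_ne_zero hx_int hx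
  have haeval : aeval x⁻¹ (minpoly F x).reverse = 0 := by
    let : Invertible x := invertibleOfNonzero hx
    rw [← invOf_eq_inv x]
    exact (eval₂_reverse_eq_zero_iff (algebraMap F K) x (minpoly F x)).mpr (minpoly.aeval F x)
  have hmonic : (C ((minpoly F x).coeff 0)⁻¹ * (minpoly F x).reverse).Monic := by
    rw [Monic, leadingCoeff_mul, leadingCoeff_C, reverse_leadingCoeff, trailingCoeff,
      natTrailingDegree_eq_zero.mpr (Or.inr hcoeff), inv_mul_cancel₀ hcoeff]
  refine (eq_of_monic_of_dvd_of_natDegree_le (minpoly.monic hx_int') hmonic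
    (minpoly.dvd F _ (by rw [map_mul, haeval, mul_zero])) ?_).symm
  rw [natDegree_C_mul (inv_ne_zero hcoeff), natDegree_reverse_of_coeff_zero_ne_zero hcoeff,
    ← IntermediateField.adjoin.finrank hx_int, ← IntermediateField.adjoin.finrank hx_int',
    adjoin_simple_inv]

theorem nextCoeff_minpoly_inv {x : K} (hx : x ≠ 0) :
    (minpoly F x⁻¹).nextCoeff = (minpoly F x).coeff 1 / (minpoly F x).coeff 0 := by
  have hx_int : IsIntegral F x := .of_finite F x
  have hcoeff := minpoly.coeff_zero_ne_zero hx_int hx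
  have hpos : 0 < (minpoly F x).natDegree := minpoly.natDegree_pos hx_int
  rw [minpoly_inv hx, nextCoeff, natDegree_C_mul (inv_ne_zero hcoeff),
    natDegree_reverse_of_coeff_zero_ne_zero hcoeff, if_neg hpos.ne', coeff_C_mul, coeff_reverse,
    revAt_le (Nat.sub_le _ _), Nat.sub_sub_self hpos, inv_mul_eq_div]

theorem finrank_div_natDegree_minpoly (x : K) :
    Module.finrank F K / (minpoly F x).natDegree =
      Module.finrank (IntermediateField.adjoin F {x}) K := by
  rw [← IntermediateField.adjoin.finrank (.of_finite F x : IsIntegral F x),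
    ← Module.finrank_mul_finrank F (IntermediateField.adjoin F {x}) K]
  exact Nat.mul_div_cancel_left _ Module.finrank_pos

variable {R : Type*} [CommRing R] [DecidableEq F]

theorem kloostermanCharacter_minpoly_pow (ψ : AddChar F R) (α : Fˣ) {x : K} (hx : x ≠ 0) :
    kloostermanCharacter ψ α (minpoly F x) ^ (Module.finrank F K / (minpoly F x).natDegree) =
      ψ (Algebra.trace F K (x + algebraMap F K α / x)) := by
  have hcoeff : (minpoly F x).coeff 0 ≠ 0 := minpoly.coeff_zero_ne_zero (.of_finite F x) hx
  rw [kloostermanCharacter, if_neg hcoeff, ← AddChar.map_nsmul_eq_pow,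
    div_eq_mul_inv (algebraMap F K α) x, ← Algebra.smul_def, map_add, LinearMap.map_smul,
    trace_eq_finrank_mul_minpoly_nextCoeff, trace_eq_finrank_mul_minpoly_nextCoeff,
    nextCoeff_minpoly_inv hx, finrank_div_natDegree_minpoly, adjoin_simple_inv, nsmul_eq_mul,
    smul_eq_mul]
  congr 1
  ring

theorem sum_addChar_trace_eq_primePowerSum [Finite F] [Fintype K] [DecidableEq K]
    (ψ : AddChar F R) (α : Fˣ) :
    ∑ x : Kˣ, ψ (Algebra.trace F K (x + algebraMap F K α / x)) =
      primePowerSum (kloostermanCharacter ψ α) (Module.finrank F K) := by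
  rw [← sum_minpoly_eq_primePowerSum]
  refine Fintype.sum_of_injective _ Units.val_injective _ _ (fun x hx => ?_)
    fun x => (kloostermanCharacter_minpoly_pow ψ α x.ne_zero).symm
  obtain rfl : x = 0 := by_contra fun hx₀ => hx ⟨Units.mk0 x hx₀, rfl⟩
  rw [minpoly.zero, natDegree_X, Nat.div_one, kloostermanCharacter, if_pos coeff_X_zero,
    zero_pow Module.finrank_pos.ne']

end Trace

section WeilBound

theorem le_of_forall_pow_le_mul_pow_add_one {t q C : ℝ} (hq : 1 ≤ q)
    (h : ∀ s : ℕ, 2 ≤ s → t ^ s ≤ C * q ^ s + 1) : t ≤ q := by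
  by_contra! hqt
  have hq₀ : 0 < q := by linarith
  have hratio : 1 < t / q := (one_lt_div hq₀).mpr hqt
  obtain ⟨n, hn⟩ := pow_unbounded_of_one_lt (C + 1) hratio
  have hgrowth : C + 1 < (t / q) ^ (n + 2) :=
    hn.trans_le (pow_le_pow_right₀ hratio.le (Nat.le_add_right n 2))
  rw [div_pow, lt_div_iff₀ (by positivity)] at hgrowth
  have hone : 1 ≤ q ^ (n + 2) := one_le_pow₀ hq
  linarith [h (n + 2) (Nat.le_add_left 2 n)]

variable {F : Type*} [Field F] [Fintype F]

theorem addChar_trace_pow_card_sub {R : Type*} [CommRing R] (ψ : AddChar F R) {K : Type*}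
    [Field K] [Finite K] [Algebra F K] (y : K) :
    ψ (Algebra.trace F K (y ^ Fintype.card F - y)) = 1 := by
  have hfrob : Algebra.trace F K (y ^ Fintype.card F) = Algebra.trace F K y :=
    Algebra.trace_eq_of_algEquiv (FiniteField.frobeniusAlgEquivOfAlgebraic F K) y
  rw [map_sub, hfrob, sub_self, AddChar.map_zero_eq_one]

variable [DecidableEq F]

theorem conj_kloostermanSum (ψ : AddChar F ℂ) (α : Fˣ) :
    (starRingEnd ℂ) (kloostermanSum ψ α) = kloostermanSum ψ α := by
  rw [kloostermanSum, map_neg, map_sum]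
  congr 1
  refine Fintype.sum_equiv (Equiv.neg Fˣ) _ _ fun x => ?_
  rw [← AddChar.map_neg_eq_conj, Equiv.neg_apply, Units.val_neg, div_neg, neg_add]

theorem norm_primePowerSum_kloostermanCharacter_le (hF : ringChar F ≠ 2) {ψ : AddChar F ℂ}
    (hψ : ψ ≠ 1) (α : Fˣ) {s : ℕ} (hs : 2 ≤ s) :
    ‖primePowerSum (kloostermanCharacter ψ α) (2 * s)‖ ≤
      2 * Fintype.card F * (Fintype.card F : ℝ) ^ s + 1 := by
  classical
  have hF₀ : (ringChar F).Prime := CharP.char_is_prime F _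
  have := Fact.mk hF₀
  have : NeZero (2 * s) := ⟨by omega⟩
  let K := FiniteField.Extension F (ringChar F) (2 * s)
  let : Fintype K := Fintype.ofFinite K
  have : CharP K (ringChar F) :=
    charP_of_injective_algebraMap (algebraMap F K).injective (ringChar F)
  obtain ⟨f, -, hq⟩ := FiniteField.card F (ringChar F)
  have hqs : ringChar F ^ (f * s : ℕ) = Fintype.card F ^ s := by rw [hq, pow_mul]
  have hcard : Fintype.card K = (ringChar F ^ (f * s : ℕ)) ^ 2 := by
    rw [← Nat.card_eq_fintype_card, FiniteField.natCard_extension, Nat.card_eq_fintype_card, hqs,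
      mul_comm, pow_mul]
  have hthree : 3 ≤ Fintype.card F := by
    rw [hq]
    exact (hF₀.two_le.lt_of_ne' hF).trans_le (Nat.le_self_pow f.ne_zero _)
  have hsize : 2 * Fintype.card F < ringChar F ^ (f * s : ℕ) := by
    rw [hqs]
    calc 2 * Fintype.card F < Fintype.card F ^ 2 := by nlinarith
      _ ≤ Fintype.card F ^ s := Nat.pow_le_pow_right (by omega) hs
  let Ψ : AddChar K ℂ := ψ.compAddMonoidHom (Algebra.trace F K).toAddMonoidHom
  have hΨ : Ψ ≠ 1 := by
    obtain ⟨c, hc⟩ := AddChar.ne_one_iff.mp hψ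
    obtain ⟨y, rfl⟩ := Algebra.trace_surjective F K c
    exact AddChar.ne_one_iff.mpr ⟨y, hc⟩
  have hbound := norm_sum_kloosterman_le hF hcard Fintype.one_lt_card hsize
    (Units.map (algebraMap F K : F →* K) α) hΨ (addChar_trace_pow_card_sub ψ)
  have hcast : (Fintype.card F : ℝ) ^ s = (ringChar F : ℝ) ^ (f * s : ℕ) := mod_cast hqs.symm
  rwa [← FiniteField.finrank_extension F (ringChar F) (2 * s),
    ← sum_addChar_trace_eq_primePowerSum (K := K), hcast]

/-- If the bound failed, the two reciprocal roots `u`, `v` of the `L`-function would be real, and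
the power sums `u ^ (2 * s) + v ^ (2 * s) = O(q ^ s)` would force `u ^ 2, v ^ 2 ≤ q`. -/
theorem norm_kloostermanSum_le (hF : ringChar F ≠ 2) {ψ : AddChar F ℂ} (hψ : ψ ≠ 1) (α : Fˣ) :
    ‖kloostermanSum ψ α‖ ≤ 2 * √(Fintype.card F) := by
  obtain ⟨r, hr⟩ := Complex.conj_eq_iff_real.mp (conj_kloostermanSum ψ α)
  set q := (Fintype.card F : ℝ)
  have hq₁ : 1 ≤ q := Nat.one_le_cast.mpr Fintype.card_pos
  rw [hr, Complex.norm_real, Real.norm_eq_abs]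
  refine abs_le_of_sq_le_sq ?_ (by positivity)
  rw [mul_pow, Real.sq_sqrt (by linarith)]
  by_contra! hlt
  obtain ⟨u, v, hadd, hmul⟩ : ∃ u v : ℝ, u + v = r ∧ u * v = q := by
    have hdisc : √(r ^ 2 - 4 * q) ^ 2 = r ^ 2 - 4 * q := Real.sq_sqrt (by linarith)
    exact ⟨(r + √(r ^ 2 - 4 * q)) / 2, (r - √(r ^ 2 - 4 * q)) / 2, by ring, by linarith⟩
  have hpow (s : ℕ) (hs : 2 ≤ s) : (u ^ 2) ^ s + (v ^ 2) ^ s ≤ 2 * q * q ^ s + 1 := by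
    have hsum := primePowerSum_kloostermanCharacter hψ α (u := (u : ℂ)) (v := (v : ℂ))
      (by rw [hr, ← hadd, Complex.ofReal_add]) (by exact_mod_cast hmul) (2 * s - 1)
    rw [Nat.sub_add_cancel (by omega), pow_mul, pow_mul] at hsum
    calc (u ^ 2) ^ s + (v ^ 2) ^ s = ‖primePowerSum (kloostermanCharacter ψ α) (2 * s)‖ := by
          rw [hsum, norm_neg, ← Real.norm_of_nonneg (by positivity : 0 ≤ (u ^ 2) ^ s + (v ^ 2) ^ s),
            ← Complex.norm_real]
          push_cast
          rfl
      _ ≤ 2 * q * q ^ s + 1 := norm_primePowerSum_kloostermanCharacter_le hF hψ α hs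
  have hu : u ^ 2 ≤ q := le_of_forall_pow_le_mul_pow_add_one hq₁ fun s hs =>
    (le_add_of_nonneg_right (by positivity)).trans (hpow s hs)
  have hv : v ^ 2 ≤ q := le_of_forall_pow_le_mul_pow_add_one hq₁ fun s hs =>
    (le_add_of_nonneg_left (by positivity)).trans (hpow s hs)
  have hsq : r ^ 2 = u ^ 2 + v ^ 2 + 2 * q := by rw [← hadd, ← hmul]; ring
  linarith

end WeilBound

section NumberField

variable {K : Type*} [Field K] [NumberField K]

theorem one_le_norm_mul_pow_finrank {x : 𝓞 K} (hx : x ≠ 0) {B : ℝ}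
    (hB : ∀ σ : K →+* ℂ, ‖σ x‖ ≤ B) (σ : K →+* ℂ) :
    1 ≤ ‖σ x‖ * B ^ (Module.finrank ℚ K - 1) := by
  have hhouse : house (x : K) ≤ B := (canonicalEmbedding.norm_le_iff (x : K) B).mpr hB
  calc (1 : ℝ) ≤ |Algebra.norm ℤ x| := mod_cast Int.one_le_abs (Algebra.norm_ne_zero_iff.mpr hx)
    _ = ‖Algebra.norm ℚ (x : K)‖ := by
      rw [← Algebra.coe_norm_int, ← Rat.norm_cast_real, Real.norm_eq_abs]
      norm_cast
    _ ≤ ‖σ x‖ * house (x : K) ^ (Module.finrank ℚ K - 1) := norm_norm_le_norm_mul_house_pow _ σ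
    _ ≤ ‖σ x‖ * B ^ (Module.finrank ℚ K - 1) := by
      gcongr
      exact house_nonneg _

variable {M : ℕ} [NeZero M]

theorem one_le_norm_mul_pow_totient [IsCyclotomicExtension {M} ℚ K] {x : 𝓞 K} (hx : x ≠ 0) {B : ℝ}
    (hB : ∀ σ : K →+* ℂ, ‖σ x‖ ≤ B) (σ : K →+* ℂ) : 1 ≤ ‖σ x‖ * B ^ (M.totient - 1) := by
  rw [← IsCyclotomicExtension.finrank K (cyclotomic.irreducible_rat (NeZero.pos M))]
  exact one_le_norm_mul_pow_finrank hx hB σ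

theorem mem_range_of_pow_eq_one [IsCyclotomicExtension {M} ℚ K] (σ : K →+* ℂ) {z : ℂ}
    (hz : z ^ M = 1) : z ∈ (σ.comp (algebraMap (𝓞 K) K)).range := by
  have hζ := IsCyclotomicExtension.zeta_spec M ℚ K
  obtain ⟨i, -, rfl⟩ := (hζ.map_of_injective σ.injective).eq_pow_of_pow_eq_one hz
  exact pow_mem (RingHom.mem_range.mpr ⟨hζ.toInteger, rfl⟩) i

end NumberField

section Characters

variable {R S : Type*} [CommRing R] [CommRing S] {f : R →+* S}

theorem exists_compAddChar_eq {A : Type*} [AddMonoid A] (hf : Function.Injective f)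
    {ψ : AddChar A S} (hψ : ∀ x, ψ x ∈ f.range) :
    ∃ ψ₀ : AddChar A R, (f : R →* S).compAddChar ψ₀ = ψ := by
  choose g hg using hψ
  exact ⟨{ toFun := g
           map_zero_eq_one' := hf (by rw [hg, map_one, AddChar.map_zero_eq_one])
           map_add_eq_mul' := fun x y => hf (by
             rw [map_mul, hg, hg, hg, AddChar.map_add_eq_mul]) }, DFunLike.ext _ _ hg⟩

theorem exists_ringHomComp_eq {A : Type*} [CommMonoid A] (hf : Function.Injective f)
    {χ : MulChar A S} (hχ : ∀ x, χ x ∈ f.range) :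
    ∃ χ₀ : MulChar A R, χ₀.ringHomComp f = χ := by
  choose g hg using hχ
  exact ⟨{ toFun := g
           map_one' := hf (by rw [hg, map_one, map_one])
           map_mul' := fun x y => hf (by rw [map_mul, hg, hg, hg, map_mul])
           map_nonunit' := fun x hx => hf (by rw [hg, map_zero, χ.map_nonunit hx]) },
    DFunLike.ext _ _ hg⟩

theorem compAddChar_ne_one_iff {A : Type*} [AddMonoid A] (hf : Function.Injective f)
    {ψ : AddChar A R} : (f : R →* S).compAddChar ψ ≠ 1 ↔ ψ ≠ 1 := by
  have hone : (f : R →* S).compAddChar (1 : AddChar A R) = 1 := DFunLike.ext _ _ fun _ => map_one f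
  rw [← hone, (MonoidHom.compAddChar_injective_right (f : R →* S) hf).ne_iff]

theorem compAddChar_inv {A : Type*} [AddCommGroup A] (f : R →+* S) (ψ : AddChar A R) :
    (f : R →* S).compAddChar ψ⁻¹ = ((f : R →* S).compAddChar ψ)⁻¹ :=
  rfl

variable {F : Type*} [Field F]

theorem pow_orderOf_apply [Finite F] (χ : MulChar F R) {x : F} (hx : x ≠ 0) :
    χ x ^ orderOf χ = 1 := by
  rw [← MulChar.pow_apply' χ χ.orderOf_pos.ne', pow_orderOf_eq_one,
    MulChar.one_apply (Ne.isUnit hx)]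

theorem addChar_pow_char (p : ℕ) [CharP F p] (ψ : AddChar F R) (x : F) : ψ x ^ p = 1 := by
  rw [← AddChar.map_nsmul_eq_pow, nsmul_eq_mul, CharP.cast_eq_zero, zero_mul,
    AddChar.map_zero_eq_one]

variable [Fintype F]

theorem map_kloostermanSum [DecidableEq F] (f : R →+* S) (ψ : AddChar F R) (α : Fˣ) :
    f (kloostermanSum ψ α) = kloostermanSum ((f : R →* S).compAddChar ψ) α := by
  rw [kloostermanSum, map_neg, map_sum]
  rfl

theorem map_gaussSum (f : R →+* S) (χ : MulChar F R) (ψ : AddChar F R) :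
    f (gaussSum χ ψ) = gaussSum (χ.ringHomComp f) ((f : R →* S).compAddChar ψ) := by
  simp only [gaussSum, map_sum, map_mul]
  rfl

end Characters

section Reduction

universe u

theorem exists_ringHom_charP (A : Type u) [CommRing A] [CharZero A] [Algebra.IsIntegral ℤ A]
    (p : ℕ) [hp : Fact p.Prime] :
    ∃ (k : Type u) (_ : Field k) (_ : A →+* k), CharP k p := by
  have : (Ideal.span {(p : ℤ)}).IsMaximal :=
    PrincipalIdealRing.isMaximal_of_irreducible (Nat.prime_iff_prime_int.mp hp.out).irreducible
  obtain ⟨Q, hQ, hQp⟩ :=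
    Ideal.exists_maximal_ideal_liesOver_of_isIntegral (S := A) (Ideal.span {(p : ℤ)})
  let := Ideal.Quotient.field Q
  refine ⟨A ⧸ Q, inferInstance, Ideal.Quotient.mk Q, ?_⟩
  rw [CharP.charP_iff_prime_eq_zero hp.out, ← map_natCast (Ideal.Quotient.mk Q),
    Ideal.Quotient.eq_zero_iff_mem, ← map_natCast (algebraMap ℤ A), ← Ideal.mem_comap,
    ← Ideal.under_def, ← hQp.over]
  exact Ideal.mem_span_singleton_self (p : ℤ)

variable {F : Type*} [Field F] (p : ℕ) [CharP F p] {k : Type*} [Field k] [CharP k p]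

include p in
theorem card_eq_zero_of_charP [Fintype F] : (Fintype.card F : k) = 0 := by
  rw [CharP.cast_eq_zero_iff k p, ← CharP.cast_eq_zero_iff F p, FiniteField.cast_card_eq_zero]

variable [Fact p.Prime]

include p in
theorem addChar_eq_one_of_charP (ψ : AddChar F k) : ψ = 1 := by
  refine DFunLike.ext _ _ fun x => sub_eq_zero.mp (eq_zero_of_pow_eq_zero (n := p) ?_)
  rw [sub_pow_char, addChar_pow_char, AddChar.one_apply, one_pow, sub_self]

variable [Fintype F] {R : Type*} [CommRing R] (f : R →+* k)

include p in
theorem map_kloostermanSum_eq_one [DecidableEq F] (ψ : AddChar F R) (α : Fˣ) :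
    f (kloostermanSum ψ α) = 1 := by
  rw [map_kloostermanSum, addChar_eq_one_of_charP p ((f : R →* k).compAddChar ψ), kloostermanSum]
  simp only [AddChar.one_apply, Finset.sum_const, Finset.card_univ, nsmul_eq_mul, mul_one]
  rw [Fintype.card_units, Nat.cast_sub Fintype.card_pos, card_eq_zero_of_charP p, Nat.cast_one,
    zero_sub, neg_neg]

include p in
theorem map_gaussSum_eq_zero [IsDomain R] {χ : MulChar F R} (hχ : χ ≠ 1) (ψ : AddChar F R) :
    f (gaussSum χ ψ) = 0 := by
  have hone : (f : R →* k).compAddChar (1 : AddChar F R) = 1 := addChar_eq_one_of_charP p _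
  rw [map_gaussSum, addChar_eq_one_of_charP p ((f : R →* k).compAddChar ψ), ← hone,
    ← map_gaussSum, gaussSum_one_right hχ, map_zero]

end Reduction

section Dickson

variable {R S : Type*} [CommRing R] [CommRing S]

/-- The quantity `(u ^ N - v ^ N) ^ 2`, where `u` and `v` are the roots of `X ^ 2 - x * X + q`,
written in terms of the Dickson polynomial with value `u ^ N + v ^ N` at `x`. It detects whether
`u / v` is an `N`-th root of unity. -/
noncomputable def dicksonDiscr (q x : R) (N : ℕ) : R :=
  (dickson 1 q N).eval x ^ 2 - 4 * q ^ N

theorem map_dicksonDiscr (f : R →+* S) (q x : R) (N : ℕ) :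
    f (dicksonDiscr q x N) = dicksonDiscr (f q) (f x) N := by
  rw [dicksonDiscr, dicksonDiscr, ← map_dickson, eval_map_apply, map_sub, map_pow, map_mul, map_pow,
    map_ofNat]

theorem dickson_one_zero (n : ℕ) : dickson 1 (0 : R) (n + 1) = X ^ (n + 1) := by
  induction n with
  | zero => rw [zero_add, dickson_one, pow_one]
  | succ n ih => rw [dickson_add_two, ih, C_0, zero_mul, sub_zero, ← pow_succ']

theorem dicksonDiscr_zero_one {N : ℕ} (hN : N ≠ 0) : dicksonDiscr (0 : R) 1 N = 1 := by
  obtain ⟨n, rfl⟩ := Nat.exists_eq_succ_of_ne_zero hN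
  rw [dicksonDiscr, dickson_one_zero, eval_pow, eval_X, one_pow, one_pow, zero_pow hN, mul_zero,
    sub_zero]

theorem eval_dickson_two_mul_cos (r θ : ℝ) (N : ℕ) :
    (dickson 1 (r ^ 2) N).eval (2 * r * Real.cos θ) = 2 * r ^ N * Real.cos (N * θ) := by
  induction N using Nat.twoStepInduction with
  | zero => norm_num
  | one => simp
  | more n ih ih' =>
    have hadd : Real.cos ((n + 2 : ℕ) * θ) =
        2 * Real.cos θ * Real.cos ((n + 1 : ℕ) * θ) - Real.cos (n * θ) := by
      have hpred : (n : ℝ) * θ = (n + 1 : ℕ) * θ - θ := by push_cast; ring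
      have hsucc : ((n + 2 : ℕ) : ℝ) * θ = (n + 1 : ℕ) * θ + θ := by push_cast; ring
      rw [hpred, hsucc, Real.cos_add, Real.cos_sub]
      ring
    rw [dickson_add_two, eval_sub, eval_mul, eval_mul, eval_X, eval_C, ih, ih', hadd]
    ring

theorem dicksonDiscr_two_mul_cos (r θ : ℝ) (N : ℕ) :
    dicksonDiscr (r ^ 2) (2 * r * Real.cos θ) N = -(2 * r ^ N * Real.sin (N * θ)) ^ 2 := by
  rw [dicksonDiscr, eval_dickson_two_mul_cos, mul_pow, Real.cos_sq']
  ring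

end Dickson

section GaussSums

variable {F : Type*} [Field F] [Fintype F]

theorem norm_mul_cos_argTwoPi (z : ℂ) : ‖z‖ * Real.cos (argTwoPi z) = z.re := by
  rw [argTwoPi, ← self_sub_toIcoDiv_zsmul, zsmul_eq_mul, Real.cos_sub_int_mul_two_pi]
  exact Complex.norm_mul_cos_arg z

theorem norm_gaussSum {χ : MulChar F ℂ} (hχ : χ ≠ 1) {ψ : AddChar F ℂ} (hψ : ψ ≠ 1) :
    ‖gaussSum χ ψ‖ = √(Fintype.card F) := by
  have hprod := gaussSum_mul_gaussSum_eq_card hχ (AddChar.IsPrimitive.of_ne_one hψ)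
  rw [← star_gaussSum_eq, ← starRingEnd_apply, Complex.mul_conj] at hprod
  rw [Complex.norm_def]
  congr 1
  exact_mod_cast hprod

theorem gaussSum_add_gaussSum_inv {χ : MulChar F ℂ} (hχ : χ ≠ 1) {ψ : AddChar F ℂ} (hψ : ψ ≠ 1) :
    gaussSum χ ψ + gaussSum χ⁻¹ ψ⁻¹ =
      (-(2 * √(Fintype.card F) * Real.cos (argTwoPi (signedGaussSum χ ψ))) : ℝ) := by
  rw [← star_gaussSum_eq, ← starRingEnd_apply, Complex.add_conj, mul_assoc, ← norm_gaussSum hχ hψ,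
    ← norm_neg, ← signedGaussSum, norm_mul_cos_argTwoPi, signedGaussSum, Complex.neg_re, mul_neg,
    neg_neg]

end GaussSums

section Angles

variable {F : Type*} [Field F] [Fintype F] [DecidableEq F]

theorem kloostermanSum_eq_cos_arccos (hF : ringChar F ≠ 2) {ψ : AddChar F ℂ} (hψ : ψ ≠ 1)
    (α : Fˣ) :
    kloostermanSum ψ α = (2 * √(Fintype.card F) *
      Real.cos (Real.arccos ((kloostermanSum ψ α).re / (2 * √(Fintype.card F)))) : ℝ) := by
  have hpos : 0 < 2 * √(Fintype.card F) :=
    mul_pos two_pos (Real.sqrt_pos.mpr (Nat.cast_pos.mpr Fintype.card_pos))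
  obtain ⟨hlower, hupper⟩ := abs_le.mp
    ((Complex.abs_re_le_norm _).trans (norm_kloostermanSum_le hF hψ α))
  rw [Real.cos_arccos, mul_div_cancel₀ _ hpos.ne',
    Complex.conj_eq_iff_re.mp (conj_kloostermanSum ψ α)]
  · rwa [le_div_iff₀ hpos, neg_one_mul]
  · rwa [div_le_one hpos]

theorem norm_dicksonDiscr_two_mul_cos (r θ : ℝ) (N : ℕ) :
    ‖dicksonDiscr ((r : ℂ) ^ 2) ((2 * r * Real.cos θ : ℝ) : ℂ) N‖ =
      (2 * r ^ N * Real.sin (N * θ)) ^ 2 := by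
  have hmap := map_dicksonDiscr Complex.ofRealHom (r ^ 2) (2 * r * Real.cos θ) N
  rw [dicksonDiscr_two_mul_cos, map_pow] at hmap
  change _ = dicksonDiscr ((r : ℂ) ^ 2) ((2 * r * Real.cos θ : ℝ) : ℂ) N at hmap
  rw [← hmap, Complex.ofRealHom_eq_coe, Complex.norm_real, norm_neg,
    Real.norm_of_nonneg (sq_nonneg _)]

variable {A : Type*} [CommRing A]

theorem norm_dicksonDiscr_kloostermanSum (f : A →+* ℂ) {ψ : AddChar F A} {α : Fˣ} {θ : ℝ}
    (hθ : f (kloostermanSum ψ α) = (2 * √(Fintype.card F) * Real.cos θ : ℝ)) (N : ℕ) :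
    ‖f (dicksonDiscr (Fintype.card F : A) (kloostermanSum ψ α) N)‖ =
      (2 * √(Fintype.card F) ^ N * Real.sin (N * θ)) ^ 2 := by
  have hcard : ((√(Fintype.card F) : ℝ) : ℂ) ^ 2 = Fintype.card F :=
    mod_cast Real.sq_sqrt (Nat.cast_nonneg (Fintype.card F))
  rw [map_dicksonDiscr, hθ, map_natCast, ← hcard, norm_dicksonDiscr_two_mul_cos]

theorem norm_kloostermanSum_add_gaussSum (f : A →+* ℂ) {ψ ψ' : AddChar F A} {α : Fˣ} {θ : ℝ}
    (hθ : f (kloostermanSum ψ α) = (2 * √(Fintype.card F) * Real.cos θ : ℝ))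
    (hψ' : (f : A →* ℂ).compAddChar ψ' ≠ 1) {χ : MulChar F A} (hχ : χ.ringHomComp f ≠ 1) :
    ‖f (kloostermanSum ψ α + (gaussSum χ ψ' + gaussSum χ⁻¹ ψ'⁻¹))‖ = 2 * √(Fintype.card F) *
      |Real.cos θ - Real.cos (argTwoPi (f (signedGaussSum χ ψ')))| := by
  have hangle : f (signedGaussSum χ ψ') =
      signedGaussSum (χ.ringHomComp f) ((f : A →* ℂ).compAddChar ψ') := by
    rw [signedGaussSum, map_neg, map_gaussSum, signedGaussSum]
  rw [map_add, map_add, hθ, map_gaussSum, map_gaussSum, compAddChar_inv, ← MulChar.ringHomComp_inv,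
    gaussSum_add_gaussSum_inv hχ hψ', hangle, ← Complex.ofReal_add, Complex.norm_real,
    ← sub_eq_add_neg, ← mul_sub, norm_mul, Real.norm_of_nonneg (by positivity), Real.norm_eq_abs]

variable (p : ℕ) [Fact p.Prime] [CharP F p]

section IsIntegral

variable [CharZero A] [Algebra.IsIntegral ℤ A]

include p

theorem dicksonDiscr_kloostermanSum_ne_zero (ψ : AddChar F A) (α : Fˣ) {N : ℕ} (hN : N ≠ 0) :
    dicksonDiscr (Fintype.card F : A) (kloostermanSum ψ α) N ≠ 0 := by
  obtain ⟨k, _, f, _⟩ := exists_ringHom_charP A p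
  refine ne_zero_of_map (f := f) ?_
  rw [map_dicksonDiscr, map_natCast, card_eq_zero_of_charP p, map_kloostermanSum_eq_one p,
    dicksonDiscr_zero_one hN]
  exact one_ne_zero

theorem kloostermanSum_add_gaussSum_ne_zero [IsDomain A] (ψ ψ' : AddChar F A) (α : Fˣ)
    {χ : MulChar F A} (hχ : χ ≠ 1) :
    kloostermanSum ψ α + (gaussSum χ ψ' + gaussSum χ⁻¹ ψ'⁻¹) ≠ 0 := by
  obtain ⟨k, _, f, _⟩ := exists_ringHom_charP A p
  refine ne_zero_of_map (f := f) ?_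
  rw [map_add, map_add, map_kloostermanSum_eq_one p, map_gaussSum_eq_zero p f hχ,
    map_gaussSum_eq_zero p f (inv_ne_one.mpr hχ), add_zero, add_zero]
  exact one_ne_zero

end IsIntegral

section NumberField

variable {K : Type*} [Field K]

theorem injective_comp_algebraMap_ringOfIntegers (σ : K →+* ℂ) :
    Function.Injective (σ.comp (algebraMap (𝓞 K) K)) :=
  σ.injective.comp RingOfIntegers.coe_injective

variable [NumberField K] {ψ ψ' : AddChar F (𝓞 K)} {α : Fˣ} {θ : ℝ}

theorem one_le_pow_mul_abs_sin_of_ringOfIntegers (hp : p ≠ 2) [IsCyclotomicExtension {p} ℚ K]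
    (hψ : ψ ≠ 1) (σ : K →+* ℂ)
    (hθ : σ (kloostermanSum ψ α : 𝓞 K) = (2 * √(Fintype.card F) * Real.cos θ : ℝ))
    {N : ℕ} (hN : N ≠ 0) :
    1 ≤ (2 * √(Fintype.card F) ^ N) ^ (p - 1) * |Real.sin (N * θ)| := by
  have : NeZero p := ⟨(Fact.out : p.Prime).ne_zero⟩
  set B : ℝ := 2 * √(Fintype.card F) ^ N
  have hnorm {θ : ℝ} (τ : K →+* ℂ)
      (hθ : τ (kloostermanSum ψ α : 𝓞 K) = (2 * √(Fintype.card F) * Real.cos θ : ℝ)) :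
      ‖τ (dicksonDiscr (Fintype.card F : 𝓞 K) (kloostermanSum ψ α) N : 𝓞 K)‖ =
        (B * Real.sin (N * θ)) ^ 2 :=
    norm_dicksonDiscr_kloostermanSum (τ.comp (algebraMap (𝓞 K) K)) hθ N
  have hle (τ : K →+* ℂ) :
      ‖τ (dicksonDiscr (Fintype.card F : 𝓞 K) (kloostermanSum ψ α) N : 𝓞 K)‖ ≤ B ^ 2 := by
    have hcos := kloostermanSum_eq_cos_arccos (by rwa [ringChar.eq F p])
      ((compAddChar_ne_one_iff (injective_comp_algebraMap_ringOfIntegers τ)).mpr hψ) α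
    rw [hnorm τ ((map_kloostermanSum _ ψ α).trans hcos), mul_pow]
    exact mul_le_of_le_one_right (sq_nonneg B) (Real.sin_sq_le_one _)
  have hliouville := one_le_norm_mul_pow_totient (M := p)
    (dicksonDiscr_kloostermanSum_ne_zero p ψ α hN) hle σ
  rw [hnorm σ hθ, Nat.totient_prime Fact.out] at hliouville
  rw [← one_le_sq_iff₀ (by positivity)]
  calc (1 : ℝ) ≤ (B * Real.sin (N * θ)) ^ 2 * (B ^ 2) ^ (p - 1 - 1) := hliouville
    _ = (B ^ 2) ^ (p - 1) * |Real.sin (N * θ)| ^ 2 := by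
      rw [mul_pow, mul_right_comm, ← pow_succ',
        Nat.sub_add_cancel (Nat.sub_pos_of_lt (Fact.out : p.Prime).one_lt), sq_abs]
    _ = (B ^ (p - 1) * |Real.sin (N * θ)|) ^ 2 := by rw [mul_pow _ |_|, pow_right_comm B]

theorem one_le_pow_mul_abs_cos_sub_cos_of_ringOfIntegers {M : ℕ} [NeZero M] (hp : p ≠ 2)
    [IsCyclotomicExtension {M} ℚ K] (hψ : ψ ≠ 1) (hψ' : ψ' ≠ 1) {χ : MulChar F (𝓞 K)} (hχ : χ ≠ 1)
    (σ : K →+* ℂ)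
    (hθ : σ (kloostermanSum ψ α : 𝓞 K) = (2 * √(Fintype.card F) * Real.cos θ : ℝ)) :
    1 ≤ (4 * √(Fintype.card F)) ^ M.totient *
      |Real.cos θ - Real.cos (argTwoPi (σ (signedGaussSum χ ψ' : 𝓞 K)))| := by
  set η : 𝓞 K := kloostermanSum ψ α + (gaussSum χ ψ' + gaussSum χ⁻¹ ψ'⁻¹)
  have hnorm {θ : ℝ} (τ : K →+* ℂ)
      (hθ : τ (kloostermanSum ψ α : 𝓞 K) = (2 * √(Fintype.card F) * Real.cos θ : ℝ)) :
      ‖τ η‖ = 2 * √(Fintype.card F) *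
        |Real.cos θ - Real.cos (argTwoPi (τ (signedGaussSum χ ψ' : 𝓞 K)))| :=
    have hinj := injective_comp_algebraMap_ringOfIntegers τ
    norm_kloostermanSum_add_gaussSum (τ.comp (algebraMap (𝓞 K) K)) hθ
      ((compAddChar_ne_one_iff hinj).mpr hψ') ((MulChar.ringHomComp_ne_one_iff hinj).mpr hχ)
  have hle (τ : K →+* ℂ) : ‖τ η‖ ≤ 4 * √(Fintype.card F) := by
    have hcos := kloostermanSum_eq_cos_arccos (by rwa [ringChar.eq F p])
      ((compAddChar_ne_one_iff (injective_comp_algebraMap_ringOfIntegers τ)).mpr hψ) α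
    have habs (x y : ℝ) : |Real.cos x - Real.cos y| ≤ 2 :=
      (abs_sub _ _).trans (by linarith [Real.abs_cos_le_one x, Real.abs_cos_le_one y])
    calc ‖τ η‖ ≤ 2 * √(Fintype.card F) * 2 := by
          rw [hnorm τ ((map_kloostermanSum _ ψ α).trans hcos)]
          gcongr
          exact habs _ _
      _ = 4 * √(Fintype.card F) := by ring
  set δ := |Real.cos θ - Real.cos (argTwoPi (σ (signedGaussSum χ ψ' : 𝓞 K)))|
  calc (1 : ℝ) ≤ ‖σ η‖ * (4 * √(Fintype.card F)) ^ (M.totient - 1) :=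
      one_le_norm_mul_pow_totient (kloostermanSum_add_gaussSum_ne_zero p ψ ψ' α hχ) hle σ
    _ ≤ 4 * √(Fintype.card F) * δ * (4 * √(Fintype.card F)) ^ (M.totient - 1) := by
      rw [hnorm σ hθ]
      gcongr
      norm_num
    _ = (4 * √(Fintype.card F)) ^ M.totient * δ := by
      rw [mul_right_comm, ← pow_succ', Nat.sub_add_cancel (Nat.totient_pos.mpr (NeZero.pos M))]

end NumberField

theorem one_le_pow_mul_abs_sin (hp : p ≠ 2) {ψ : AddChar F ℂ} (hψ : ψ ≠ 1) (α : Fˣ) {θ : ℝ}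
    (hθ : kloostermanSum ψ α = (2 * √(Fintype.card F) * Real.cos θ : ℝ)) {N : ℕ} (hN : N ≠ 0) :
    1 ≤ (2 * √(Fintype.card F) ^ N) ^ (p - 1) * |Real.sin (N * θ)| := by
  have : NeZero p := ⟨(Fact.out : p.Prime).ne_zero⟩
  have : IsCyclotomicExtension {p} ℚ (CyclotomicField p ℚ) :=
    CyclotomicField.isCyclotomicExtension p ℚ
  obtain ⟨σ⟩ : Nonempty (CyclotomicField p ℚ →+* ℂ) := inferInstance
  have hinj := injective_comp_algebraMap_ringOfIntegers σ
  obtain ⟨ψ₀, rfl⟩ := exists_compAddChar_eq hinj fun x =>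
    mem_range_of_pow_eq_one (M := p) σ (addChar_pow_char p ψ x)
  rw [← map_kloostermanSum] at hθ
  exact one_le_pow_mul_abs_sin_of_ringOfIntegers p hp ((compAddChar_ne_one_iff hinj).mp hψ) σ hθ hN

theorem one_le_pow_mul_abs_cos_sub_cos (hp : p ≠ 2) {ψ ψ' : AddChar F ℂ} (hψ : ψ ≠ 1)
    (hψ' : ψ' ≠ 1) (α : Fˣ) {χ : MulChar F ℂ} (hχ : χ ≠ 1) {θ : ℝ}
    (hθ : kloostermanSum ψ α = (2 * √(Fintype.card F) * Real.cos θ : ℝ)) :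
    1 ≤ (4 * √(Fintype.card F)) ^ (orderOf χ * p).totient *
      |Real.cos θ - Real.cos (argTwoPi (signedGaussSum χ ψ'))| := by
  obtain ⟨M, hM⟩ : ∃ M, M = orderOf χ * p := ⟨_, rfl⟩
  rw [← hM]
  have : NeZero M := ⟨hM ▸ mul_ne_zero χ.orderOf_pos.ne' (Fact.out : p.Prime).ne_zero⟩
  have : IsCyclotomicExtension {M} ℚ (CyclotomicField M ℚ) :=
    CyclotomicField.isCyclotomicExtension M ℚ
  obtain ⟨σ⟩ : Nonempty (CyclotomicField M ℚ →+* ℂ) := inferInstance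
  have hinj := injective_comp_algebraMap_ringOfIntegers σ
  have haddChar (φ : AddChar F ℂ) (x : F) : φ x ^ M = 1 := by
    rw [hM, mul_comm, pow_mul, addChar_pow_char, one_pow]
  have hmulChar {x : F} (hx : x ≠ 0) : χ x ^ M = 1 := by
    rw [hM, pow_mul, pow_orderOf_apply χ hx, one_pow]
  obtain ⟨ψ₀, rfl⟩ := exists_compAddChar_eq hinj fun x => mem_range_of_pow_eq_one σ (haddChar ψ x)
  obtain ⟨ψ₀', rfl⟩ := exists_compAddChar_eq hinj fun x => mem_range_of_pow_eq_one σ (haddChar ψ' x)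
  obtain ⟨χ₀, rfl⟩ := exists_ringHomComp_eq (χ := χ) hinj fun x => by
    by_cases hx : x = 0
    · rw [hx, χ.map_zero]
      exact zero_mem _
    · exact mem_range_of_pow_eq_one σ (hmulChar hx)
  rw [← map_kloostermanSum] at hθ
  rw [signedGaussSum, ← map_gaussSum, ← map_neg]
  exact one_le_pow_mul_abs_cos_sub_cos_of_ringOfIntegers p hp ((compAddChar_ne_one_iff hinj).mp hψ)
    ((compAddChar_ne_one_iff hinj).mp hψ') ((MulChar.ringHomComp_ne_one_iff hinj).mp hχ) σ hθ

end Angles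

section Exponents

theorem log_two_div_log_three_pos : 0 < Real.log 2 / Real.log 3 :=
  div_pos (Real.log_pos (by norm_num)) (Real.log_pos (by norm_num))

theorem tauExponent_pos {p N : ℕ} (hp : 2 ≤ p) (hN : 1 ≤ N) : 0 < tauExponent p N := by
  have hp' : (2 : ℝ) ≤ p := mod_cast hp
  have hN' : (1 : ℝ) ≤ N := mod_cast hN
  have hlog := log_two_div_log_three_pos
  exact add_pos_of_pos_of_nonneg (mul_pos (by linarith) (by linarith))
    (div_nonneg (Real.log_nonneg hN') (Real.log_nonneg (by norm_num)))

theorem le_sigmaExponent {p : ℕ} (hp : 1 ≤ p) (n : ℕ) :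
    2 * n * p * (Real.log 2 / Real.log 3 + 1) ≤ sigmaExponent p n := by
  have hp' : (1 : ℝ) ≤ p := mod_cast hp
  have hlog := log_two_div_log_three_pos
  rw [sigmaExponent, mul_div_assoc 2]
  gcongr
  exact le_add_of_nonneg_right (mul_nonneg (by linarith) (by linarith))

theorem sigmaExponent_pos {p n : ℕ} (hp : 1 ≤ p) (hn : 1 ≤ n) : 0 < sigmaExponent p n :=
  lt_of_lt_of_le (by positivity) (le_sigmaExponent hp n)

theorem tauExponent_one_le_sigmaExponent_one {p : ℕ} (hp : 1 ≤ p) :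
    tauExponent p 1 ≤ sigmaExponent p 1 := by
  refine le_trans ?_ (le_sigmaExponent hp 1)
  rw [tauExponent, Nat.cast_one, Real.log_one, zero_div, add_zero, mul_one]
  gcongr <;> linarith

theorem le_rpow_log_div_log_three {x q : ℝ} (hx : 1 ≤ x) (hq : 3 ≤ q) :
    x ≤ q ^ (Real.log x / Real.log 3) :=
  calc x = 3 ^ (Real.log x / Real.log 3) :=
        (Real.rpow_logb (by norm_num) (by norm_num) (one_pos.trans_le hx)).symm
    _ ≤ q ^ (Real.log x / Real.log 3) := by
        gcongr
        exact div_nonneg (Real.log_nonneg hx) (Real.log_nonneg (by norm_num))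

theorem pow_mul_le_rpow_tauExponent {p N : ℕ} {q : ℝ} (hp : 1 ≤ p) (hN : 1 ≤ N) (hq : 3 ≤ q) :
    (2 * √q ^ N) ^ (p - 1) * N ≤ q ^ tauExponent p N := by
  have hq_pos : 0 < q := by linarith
  have hN' : (1 : ℝ) ≤ N := mod_cast hN
  have hbase : 2 * √q ^ N ≤ q ^ (Real.log 2 / Real.log 3 + N / 2) := by
    rw [Real.rpow_add hq_pos, Real.rpow_div_two_eq_sqrt _ hq_pos.le, Real.rpow_natCast]
    gcongr
    exact le_rpow_log_div_log_three one_le_two hq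
  calc (2 * √q ^ N) ^ (p - 1) * N
      ≤ (q ^ (Real.log 2 / Real.log 3 + N / 2)) ^ (p - 1) * q ^ (Real.log N / Real.log 3) := by
        gcongr
        exact le_rpow_log_div_log_three hN' hq
    _ = q ^ ((Real.log 2 / Real.log 3 + N / 2) * (p - 1 : ℕ) + Real.log N / Real.log 3) := by
        rw [← Real.rpow_mul_natCast hq_pos.le, ← Real.rpow_add hq_pos]
    _ ≤ q ^ tauExponent p N := by
        rw [tauExponent, ← Nat.cast_pred hp, mul_comm (_ + _)]
        gcongr
        · linarith
        · exact le_mul_of_one_le_left (Nat.cast_nonneg _) one_le_two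

theorem pow_totient_le_rpow_sigmaExponent {p : ℕ} (hp : 1 ≤ p) (n : ℕ) {q : ℝ} (hq : 3 ≤ q) :
    (4 * √q) ^ (n * p).totient ≤ q ^ sigmaExponent p n := by
  have hq_pos : 0 < q := by linarith
  have hbase : 4 * √q ≤ q ^ (2 * (Real.log 2 / Real.log 3 + 1)) := by
    have htwo := le_rpow_log_div_log_three one_le_two hq
    calc 4 * √q = 2 ^ 2 * √q := by norm_num
      _ ≤ (q ^ (Real.log 2 / Real.log 3)) ^ 2 * q ^ 2 := by
        gcongr
        exact Real.sqrt_le_iff.mpr ⟨sq_nonneg q, by nlinarith [sq_nonneg (q ^ 2 - q)]⟩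
      _ = q ^ (2 * (Real.log 2 / Real.log 3 + 1)) := by
        rw [mul_comm 2, Real.rpow_mul hq_pos.le, Real.rpow_add hq_pos, Real.rpow_one,
          Real.rpow_two, mul_pow]
  calc (4 * √q) ^ (n * p).totient ≤ (4 * √q) ^ (n * p) :=
        pow_le_pow_right₀ (by nlinarith [Real.one_le_sqrt.mpr (show 1 ≤ q by linarith)])
          (Nat.totient_le _)
    _ ≤ (q ^ (2 * (Real.log 2 / Real.log 3 + 1))) ^ (n * p) := by gcongr
    _ = q ^ (2 * n * p * (Real.log 2 / Real.log 3 + 1)) := by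
        rw [← Real.rpow_mul_natCast hq_pos.le]
        push_cast
        ring_nf
    _ ≤ q ^ sigmaExponent p n := by
        gcongr
        · linarith
        · exact le_sigmaExponent hp n

theorem rpow_neg_le_of_one_le_mul {q A e δ : ℝ} (hq : 0 < q) (hA : A ≤ q ^ e) (hδ : 0 ≤ δ)
    (h : 1 ≤ A * δ) : q ^ (-e) ≤ δ := by
  rw [Real.rpow_neg hq.le, inv_le_iff_one_le_mul₀' (Real.rpow_pos_of_pos hq e)]
  exact h.trans (mul_le_mul_of_nonneg_right hA hδ)

end Exponents

section Distances

theorem abs_sin_nat_mul_le {N : ℕ} (hN : N ≠ 0) (j : ℕ) (θ : ℝ) :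
    |Real.sin (N * θ)| ≤ N * |θ - 2 * j * Real.pi / N| :=
  calc |Real.sin (N * θ)| = |Real.sin (N * (θ - 2 * j * Real.pi / N))| := by
        rw [← Real.sin_sub_nat_mul_two_pi _ j]
        congr 2
        field_simp
    _ ≤ |N * (θ - 2 * j * Real.pi / N)| := Real.abs_sin_le_abs
    _ = N * |θ - 2 * j * Real.pi / N| := by rw [abs_mul, Nat.abs_cast]

theorem orderOf_ringHomComp {A R S : Type*} [CommMonoid A] [CommRing R] [CommRing S] {f : R →+* S}
    (hf : Function.Injective f) (χ : MulChar A R) : orderOf (χ.ringHomComp f) = orderOf χ :=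
  orderOf_injective (MulChar.ringHomCompHom f) (MulChar.injective_ringHomComp hf) χ

variable {F : Type*} [Field F] [Fintype F]

theorem le_card_of_charP (F : Type*) [Field F] [Fintype F] (p : ℕ) [CharP F p] :
    p ≤ Fintype.card F :=
  Nat.le_of_dvd Fintype.card_pos
    ((CharP.cast_eq_zero_iff F p _).mp (FiniteField.cast_card_eq_zero F))

theorem gaussAngle_one (ι : AlgebraicClosure ℚ →+* ℂ) {ψ : AddChar F (AlgebraicClosure ℚ)}
    (hψ : ψ ≠ 1) : gaussAngle ι 1 ψ = 0 := by
  rw [gaussAngle, signedGaussSum, gaussSum_one_left hψ, neg_neg, map_one, argTwoPi,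
    Complex.arg_one, toIcoMod_apply_left]

theorem gaussAngle_eq_argTwoPi (ι : AlgebraicClosure ℚ →+* ℂ)
    (χ : MulChar F (AlgebraicClosure ℚ)) (ψ : AddChar F (AlgebraicClosure ℚ)) :
    gaussAngle ι χ ψ = argTwoPi (signedGaussSum (χ.ringHomComp ι)
      ((ι : AlgebraicClosure ℚ →* ℂ).compAddChar ψ)) := by
  rw [gaussAngle, signedGaussSum, map_neg, map_gaussSum, signedGaussSum]

variable [DecidableEq F] {p : ℕ} [Fact p.Prime] [CharP F p] {ψ : AddChar F ℂ} {α : Fˣ} {θ : ℝ}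

theorem le_infEDist_rootOfUnityAngles (hp : 3 ≤ p) (hψ : ψ ≠ 1)
    (hθ : kloostermanSum ψ α = (2 * √(Fintype.card F) * Real.cos θ : ℝ)) {N : ℕ} (hN : 1 ≤ N) :
    ENNReal.ofReal ((Fintype.card F : ℝ) ^ (-tauExponent p N)) ≤
      Metric.infEDist θ (rootOfUnityAngles N) := by
  have hcard : (3 : ℝ) ≤ Fintype.card F := mod_cast hp.trans (le_card_of_charP F p)
  have hN0 : N ≠ 0 := Nat.one_le_iff_ne_zero.mp hN
  rw [Metric.le_infEDist]
  rintro y ⟨j, -, rfl⟩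
  rw [edist_dist, Real.dist_eq]
  refine ENNReal.ofReal_le_ofReal (rpow_neg_le_of_one_le_mul (by linarith)
    (pow_mul_le_rpow_tauExponent (by linarith) hN hcard) (abs_nonneg _) ?_)
  calc (1 : ℝ) ≤ (2 * √(Fintype.card F) ^ N) ^ (p - 1) * |Real.sin (N * θ)| :=
        one_le_pow_mul_abs_sin p (by lia) hψ α hθ hN0
    _ ≤ (2 * √(Fintype.card F) ^ N) ^ (p - 1) * (N * |θ - 2 * j * Real.pi / N|) := by
        gcongr
        exact abs_sin_nat_mul_le hN0 j θ
    _ = (2 * √(Fintype.card F) ^ N) ^ (p - 1) * N * |θ - 2 * j * Real.pi / N| :=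
        (mul_assoc _ _ _).symm

theorem le_infEDist_gaussAngles (hp : 3 ≤ p) (ι : AlgebraicClosure ℚ →+* ℂ) (hψ : ψ ≠ 1)
    (hθ : kloostermanSum ψ α = (2 * √(Fintype.card F) * Real.cos θ : ℝ)) (n : ℕ) :
    ENNReal.ofReal ((Fintype.card F : ℝ) ^ (-sigmaExponent p n)) ≤
      Metric.infEDist θ (gaussAngles F ι n) := by
  have hcard : (3 : ℝ) ≤ Fintype.card F := mod_cast hp.trans (le_card_of_charP F p)
  rw [Metric.le_infEDist]
  rintro y ⟨χ, ψ', rfl, hψ', rfl⟩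
  by_cases hχ : χ = 1
  · have hzero : (0 : ℝ) ∈ rootOfUnityAngles 1 := ⟨0, one_pos, by norm_num⟩
    rw [hχ, orderOf_one, gaussAngle_one ι hψ']
    refine le_trans (ENNReal.ofReal_le_ofReal ?_)
      (Metric.le_infEDist.mp (le_infEDist_rootOfUnityAngles hp hψ hθ le_rfl) 0 hzero)
    exact Real.rpow_le_rpow_of_exponent_le (by linarith)
      (neg_le_neg (tauExponent_one_le_sigmaExponent_one (by linarith)))
  · rw [edist_dist, Real.dist_eq]
    refine ENNReal.ofReal_le_ofReal (rpow_neg_le_of_one_le_mul (by linarith)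
      (pow_totient_le_rpow_sigmaExponent (by linarith) _ hcard) (abs_nonneg _) ?_)
    rw [gaussAngle_eq_argTwoPi, ← orderOf_ringHomComp ι.injective]
    refine (one_le_pow_mul_abs_cos_sub_cos p (by lia) hψ
      ((compAddChar_ne_one_iff ι.injective).mpr hψ') α
      ((MulChar.ringHomComp_ne_one_iff ι.injective).mpr hχ) hθ).trans ?_
    exact mul_le_mul_of_nonneg_left (Real.abs_cos_sub_cos_le _ _) (by positivity)

end Distances

theorem mainTheorem8 (p N n : ℕ) (hp : p.Prime) (hp3 : 3 ≤ p) (hN : 1 ≤ N) (hn : 1 ≤ n)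
    (hnp : n.Coprime p) :
    0 < tauExponent p N ∧ 0 < sigmaExponent p n ∧
      ∀ (F : Type*) [Field F] [Fintype F] [DecidableEq F] [CharP F p]
        (ι : AlgebraicClosure ℚ →+* ℂ) (ψ : AddChar F (AlgebraicClosure ℚ)) (α : Fˣ), ψ ≠ 1 →
        -- the Kloosterman angle is well defined
        ι (kloostermanSum ψ α) =
            ((2 * √(Fintype.card F : ℝ) * Real.cos (kloostermanAngle ι ψ α) : ℝ) : ℂ) ∧
        -- `Metric.infEDist` is the infimum of the distances, and `⊤` for the empty set
        ENNReal.ofReal ((Fintype.card F : ℝ) ^ (-tauExponent p N)) ≤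
          min (Metric.infEDist (kloostermanAngle ι ψ α) (rootOfUnityAngles N))
            (Metric.infEDist (2 * Real.pi - kloostermanAngle ι ψ α) (rootOfUnityAngles N)) ∧
        ENNReal.ofReal ((Fintype.card F : ℝ) ^ (-sigmaExponent p n)) ≤
          min (Metric.infEDist (kloostermanAngle ι ψ α) (gaussAngles F ι n))
            (Metric.infEDist (2 * Real.pi - kloostermanAngle ι ψ α) (gaussAngles F ι n)) := by
  have : Fact p.Prime := ⟨hp⟩
  refine ⟨tauExponent_pos (by lia) hN, sigmaExponent_pos hp.one_le hn, ?_⟩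
  intro F _ _ _ _ ι ψ α hψ
  have hψι := (compAddChar_ne_one_iff ι.injective).mpr hψ
  have hF : ringChar F ≠ 2 := by
    rw [ringChar.eq F p]
    lia
  have hθ := kloostermanSum_eq_cos_arccos hF hψι α
  rw [← map_kloostermanSum, ← kloostermanAngle] at hθ
  have hreflected : ι (kloostermanSum ψ α) =
      (2 * √(Fintype.card F) * Real.cos (2 * Real.pi - kloostermanAngle ι ψ α) : ℝ) := by
    rwa [Real.cos_two_pi_sub]
  rw [map_kloostermanSum] at hθ hreflected ⊢
  exact ⟨hθ, le_min (le_infEDist_rootOfUnityAngles hp3 hψι hθ hN)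
      (le_infEDist_rootOfUnityAngles hp3 hψι hreflected hN),
    le_min (le_infEDist_gaussAngles hp3 ι hψι hθ n)
      (le_infEDist_gaussAngles hp3 ι hψι hreflected n)⟩
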